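/- **Setting.** Let $\Omega\subset\mathbb R^2$ be a bounded polygonal open set and let $\mathcal T_h$ be a conforming triangulation of it: a finite set of closed nondegenerate triangles, any two of which meet in the convex hull of their common vertices, with $\Omega=\operatorname{int}\bigcup_{T\in\mathcal T_h}T$. Assume that $\mathcal T_h$ is shape regular with constant $c_1$, that is, $c_1^{-1}h_T^2\le|T|\le c_1h_T^2$ for all $T\in\mathcal T_h$, where $h_T=\operatorname{diam}T$; let $h$ be the function equal to $h_T$ on $T$. Let $A\in L^\infty(\Omega;\mathbb R^{2\times2})$ be symmetric with $\lambda|\xi|^2\le\xi\cdot A\xi\le\Lambda|\xi|^2$ for all $\xi\in\mathbb R^2$, a.e. in $\Omega$, where $\lambda>0$, and let $f\in L^2(\Omega)$. Let $u\in H^1_0(\Omega)$ and $p=A\nabla u\in H(\mathrm{div},\Omega)$ be the weak solution of $-\operatorname{div}p=f$ in $\Omega$, $u=0$ on $\partial\Omega$. For an integer $l\ge0$ let $$M_h=\{q\in H(\mathrm{div},\Omega): q|_T\in M_l(T)\ \forall T\in\mathcal T_h\},\qquad L_h=\{v\in L^2(\Omega): v|_T\in P_l\ \forall T\in\mathcal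 T_h\},$$ where $P_k$ denotes the polynomials of total degree $\le k$, and $M_l(T)$ is one of $P_l^2+P_l\,x$ (Raviart–Thomas, RT), $P_{l+1}^2$ (Brezzi–Douglas–Marini, BDM), or $\{q\in P_{l+1}^2:\ q\cdot\nu|_E\text{ has degree}\le l\text{ for each edge }E\text{ of }T\}$ (Brezzi–Douglas–Fortin–Marini, BDFM), $\nu$ being the unit normal. Let $f_h$ be the $L^2(\Omega)$-projection of $f$ onto $L_h$, and let $(p_h,u_h)\in M_h\times L_h$ satisfy $$(A^{-1}p_h,q_h)_{0,\Omega}+(\operatorname{div}q_h,u_h)_{0,\Omega}=0\quad\forall q_h\in M_h,\qquad(\operatorname{div}p_h,v_h)_{0,\Omega}=-(f_h,v_h)_{0,\Omega}\quad\forall v_h\in L_h .$$ Assume that on every $T\in\mathcal T_h$ the field $A^{-1}p_h$ has a distributional curl ($\operatorname{curl}\psi=\partial_1\psi_2-\partial_2\psi_1$) in $L^2(T)$ and a tangential trace in $L^2(\partial T)$ (for instance $A^{-1}p_h|_T\in H^1(T)^2$), so that the quantities below are defined. The tangential trace of $v$ along the counterclockwise unit tangent $\tau_T$ is the function $v\cdot\tau_T$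 on $\partial T$ with $\int_T\operatorname{curl}v\,\varphi+\int_Tv\cdot(-\partial_2\varphi,\partial_1\varphi)=\int_{\partial T}(v\cdot\tau_T)\varphi$ for all smooth $\varphi$. On an edge $E$ with unit tangent $\tau$, $J(v\cdot\tau)$ denotes the jump across $E$ of the tangential traces $v\cdot\tau$ from the two adjacent triangles, or the trace itself if $E\subset\partial\Omega$. Let $n\ge l+1$ be an integer, let $\Pi_m$ be the $L^2$-best approximation by polynomials of degree $\le m$ on each triangle, respectively on each edge, and put $P_m^2=\mathrm{id}-\Pi_m$. Define $$\eta_{\mathcal T_h}(p_h,\mathcal T_h)^2=\sum_{T\in\mathcal T_h}\Big(h_T^2\|f-f_h\|_{L^2(T)}^2+h_T^2\|\operatorname{curl}(A^{-1}p_h)\|_{L^2(T)}^2+h_T\|J(A^{-1}p_h\cdot\tau)\|_{L^2(\partial T)}^2\Big),$$ $$\mathcal E_h^2=\|A^{-1/2}(p-p_h)\|_{L^2(\Omega)}^2+\|h\operatorname{div}(p-p_h)\|_{L^2(\Omega)}^2,$$ $$\mathrm{osc}_h^2=\sum_{T\in\mathcal T_h}\Big(h_T^2\|P_n^2\operatorname{curl}(A^{-1}p_h)\|_{L^2(T)}^2+h_T\|P_{n+1}^2J(A^{-1}p_h\cdot\tau)\|_{L^2(\partial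 T)}^2+h_T^2\|f-f_h\|_{L^2(T)}^2\Big).$$ **Theorem 3.5.** For all integers $l\ge0$, $n\ge l+1$ and all reals $\lambda>0$, $\Lambda$, $c_1$ there is a constant $C_2>0$, depending only on $l,n,\lambda,\Lambda,c_1$ (in particular not on the mesh size), such that in the above setting, for each of the RT, BDM and BDFM elements, $$C_2\,\eta_{\mathcal T_h}(p_h,\mathcal T_h)^2\le\mathcal E_h^2+\mathrm{osc}_h^2 .$$ -/

import Mathlib

open MeasureTheory Filter Topology
open scoped Matrix ContDiff

noncomputable section

namespace MixedFEM

/-- The Euclidean plane `ℝ²`. -/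
abbrev Plane := EuclideanSpace ℝ (Fin 2)

/-! ### Differential operators -/

/-- The classical gradient `(∂φ/∂x₁, ∂φ/∂x₂)`. -/
def grad (φ : Plane → ℝ) (x : Plane) : Fin 2 → ℝ :=
  fun i => fderiv ℝ φ x (EuclideanSpace.single i 1)

/-- `Curl φ = (-∂φ/∂x₂, ∂φ/∂x₁)`. -/
def vecCurl (φ : Plane → ℝ) (x : Plane) : Fin 2 → ℝ :=
  ![-grad φ x 1, grad φ x 0]

/-- `φ ∈ C_c^∞(U)`. -/
structure IsTestFunction (U : Set Plane) (φ : Plane → ℝ) : Prop where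
  smooth : ContDiff ℝ ∞ φ
  compact : HasCompactSupport φ
  support_subset : tsupport φ ⊆ U

/-- A scalar function in `L²(U)`. -/
def InL2 (U : Set Plane) (v : Plane → ℝ) : Prop := MemLp v 2 (volume.restrict U)

/-- A vector field in `L²(U)²`. -/
def InL2Vec (U : Set Plane) (v : Plane → Fin 2 → ℝ) : Prop := ∀ i, InL2 U (fun x => v x i)

/-- `d ∈ L²(U)` is the distributional divergence of `v` in `U`. -/
def IsWeakDiv (U : Set Plane) (v : Plane → Fin 2 → ℝ) (d : Plane → ℝ) : Prop :=
  InL2 U d ∧ ∀ φ, IsTestFunction U φ →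
    ∫ x in U, v x ⬝ᵥ grad φ x = -∫ x in U, d x * φ x

/-- `c ∈ L²(U)` is the distributional curl `∂v₂/∂x₁ - ∂v₁/∂x₂` of `v` in `U`. -/
def IsWeakCurl (U : Set Plane) (v : Plane → Fin 2 → ℝ) (c : Plane → ℝ) : Prop :=
  InL2 U c ∧ ∀ φ, IsTestFunction U φ →
    ∫ x in U, v x ⬝ᵥ vecCurl φ x = -∫ x in U, c x * φ x

/-- The space `H(div, U)`. -/
def InHDiv (U : Set Plane) (v : Plane → Fin 2 → ℝ) : Prop :=
  InL2Vec U v ∧ ∃ d, IsWeakDiv U v d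

open Classical in
/-- `div v` in `U`, for `v ∈ H(div, U)` (a representative; it is unique almost everywhere). -/
def weakDiv (U : Set Plane) (v : Plane → Fin 2 → ℝ) : Plane → ℝ :=
  if h : ∃ d, IsWeakDiv U v d then h.choose else 0

open Classical in
/-- `curl v` in `U`, if it belongs to `L²(U)` (a representative; it is unique almost
everywhere). -/
def weakCurl (U : Set Plane) (v : Plane → Fin 2 → ℝ) : Plane → ℝ :=
  if h : ∃ c, IsWeakCurl U v c then h.choose else 0

/-- `u ∈ H¹₀(Ω)` with weak gradient `G`, where `H¹₀(Ω)` is the closure of `C_c^∞(Ω)` in the norm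
of `H¹(Ω)`. -/
def IsH10 (Ω : Set Plane) (u : Plane → ℝ) (G : Plane → Fin 2 → ℝ) : Prop :=
  InL2 Ω u ∧ InL2Vec Ω G ∧
  ∃ φ : ℕ → Plane → ℝ, (∀ k, IsTestFunction Ω (φ k)) ∧
    Tendsto (fun k => eLpNorm (fun x => φ k x - u x) 2 (volume.restrict Ω)) atTop (𝓝 0) ∧
    ∀ i, Tendsto (fun k => eLpNorm (fun x => grad (φ k) x i - G x i) 2 (volume.restrict Ω))
      atTop (𝓝 0)

/-! ### Triangulations -/

/-- The closed triangle (or segment) with the given vertices. -/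
def hull (s : Finset Plane) : Set Plane := convexHull ℝ (s : Set Plane)

/-- The diameter `h_T` of a triangle. -/
def size (t : Finset Plane) : ℝ := Metric.diam (hull t)

/-- The three edges of a triangle, as pairs of vertices. -/
def edges (t : Finset Plane) : Finset (Finset Plane) := t.powersetCard 2

/-- `𝒯` (a finite set of triangles, each given by its vertices) is a conforming triangulation
of the bounded polygonal open set `Ω`. -/
structure IsTriangulation (Ω : Set Plane) (𝒯 : Finset (Finset Plane)) : Prop where
  card_eq : ∀ t ∈ 𝒯, t.card = 3
  nondegenerate : ∀ t ∈ 𝒯, AffineIndependent ℝ ((↑) : t → Plane)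
  conforming : ∀ s ∈ 𝒯, ∀ t ∈ 𝒯,
    hull s ∩ hull t = convexHull ℝ ((s : Set Plane) ∩ (t : Set Plane))
  domain_eq : Ω = interior (⋃ t ∈ 𝒯, hull t)

/-- The shape regularity (angle) condition `c₁⁻¹ h_T² ≤ |T| ≤ c₁ h_T²`. -/
def ShapeRegular (c₁ : ℝ) (𝒯 : Finset (Finset Plane)) : Prop :=
  ∀ t ∈ 𝒯, c₁⁻¹ * size t ^ 2 ≤ volume.real (hull t) ∧ volume.real (hull t) ≤ c₁ * size t ^ 2

/-- The length measure on an edge. -/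
def edgeMeasure (e : Finset Plane) : Measure Plane :=
  (Measure.hausdorffMeasure 1 : Measure Plane).restrict (hull e)

/-! ### Polynomials and finite element spaces -/

/-- The value of a bivariate polynomial at a point of the plane. -/
def peval (P : MvPolynomial (Fin 2) ℝ) (x : Plane) : ℝ := MvPolynomial.eval (fun i => x i) P

/-- `‖g - Π_m g‖²` in `L²(μ)`, where `Π_m g` is the `L²(μ)`-best approximation of `g` by
polynomials of total degree at most `m`. For `μ` the length measure on an edge, these are the
polynomials of degree at most `m` on that edge. -/
def bestApproxErrorSq (m : ℕ) (μ : Measure Plane) (g : Plane → ℝ) : ℝ :=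
  ⨅ P : {P : MvPolynomial (Fin 2) ℝ // P.totalDegree ≤ m}, ∫ x, (g x - peval P.1 x) ^ 2 ∂μ

/-- The three families of mixed elements: Raviart-Thomas, Brezzi-Douglas-Marini and
Brezzi-Douglas-Fortin-Marini. -/
inductive Family where
  | RT
  | BDM
  | BDFM

/-- A vector normal to the segment from `a` to `b` (of the length of the segment). -/
def edgeNormal (a b : Plane) : Fin 2 → ℝ := ![b 1 - a 1, -(b 0 - a 0)]

/-- The polynomial vector `Q` belongs to the local stress space `M_l(T)`:
* RT: `P_l² + P_l x`;
* BDM: `P_{l+1}²`;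
* BDFM: those `q ∈ P_{l+1}²` for which `q · ν` has degree at most `l` on each edge. -/
def InLocalStress (F : Family) (l : ℕ) (t : Finset Plane)
    (Q : Fin 2 → MvPolynomial (Fin 2) ℝ) : Prop :=
  match F with
  | Family.RT => ∃ (R : Fin 2 → MvPolynomial (Fin 2) ℝ) (S : MvPolynomial (Fin 2) ℝ),
      (∀ i, (R i).totalDegree ≤ l) ∧ S.totalDegree ≤ l ∧
      ∀ i, Q i = R i + S * MvPolynomial.X i
  | Family.BDM => ∀ i, (Q i).totalDegree ≤ l + 1
  | Family.BDFM => (∀ i, (Q i).totalDegree ≤ l + 1) ∧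
      ∀ a ∈ t, ∀ b ∈ t, ∃ r : Polynomial ℝ, r.natDegree ≤ l ∧
        ∀ s : ℝ, (fun i => peval (Q i) (a + s • (b - a))) ⬝ᵥ edgeNormal a b = r.eval s

/-- The discrete stress space `M_h`. -/
def InStressSpace (F : Family) (l : ℕ) (Ω : Set Plane) (𝒯 : Finset (Finset Plane))
    (q : Plane → Fin 2 → ℝ) : Prop :=
  InHDiv Ω q ∧ ∀ t ∈ 𝒯, ∃ Q, InLocalStress F l t Q ∧
    ∀ᵐ x ∂volume.restrict (hull t), ∀ i, q x i = peval (Q i) x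

/-- The discrete displacement space `L_h`. -/
def InDisplacementSpace (l : ℕ) (Ω : Set Plane) (𝒯 : Finset (Finset Plane))
    (v : Plane → ℝ) : Prop :=
  InL2 Ω v ∧ ∀ t ∈ 𝒯, ∃ P : MvPolynomial (Fin 2) ℝ, P.totalDegree ≤ l ∧
    ∀ᵐ x ∂volume.restrict (hull t), v x = peval P x

/-- `fh` is the `L²(Ω)`-projection of `f` onto `L_h`. -/
def IsL2Projection (l : ℕ) (Ω : Set Plane) (𝒯 : Finset (Finset Plane))
    (f fh : Plane → ℝ) : Prop :=
  InDisplacementSpace l Ω 𝒯 fh ∧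
  ∀ v, InDisplacementSpace l Ω 𝒯 v → ∫ x in Ω, (f x - fh x) * v x = 0

/-! ### The boundary value problem and its mixed discretization -/

/-- `A ∈ L^∞(Ω; ℝ^{2×2})` is symmetric and uniformly positive definite, with eigenvalues in
`[lam, Lam]`. -/
structure IsCoefficient (lam Lam : ℝ) (Ω : Set Plane) (A : Plane → Matrix (Fin 2) (Fin 2) ℝ) :
    Prop where
  measurable : ∀ i j, AEStronglyMeasurable (fun x => A x i j) (volume.restrict Ω)
  symm : ∀ᵐ x ∂volume.restrict Ω, (A x).IsSymm
  bounds : ∀ᵐ x ∂volume.restrict Ω, ∀ ξ : Fin 2 → ℝ,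
    lam * (ξ ⬝ᵥ ξ) ≤ ξ ⬝ᵥ (A x *ᵥ ξ) ∧ ξ ⬝ᵥ (A x *ᵥ ξ) ≤ Lam * (ξ ⬝ᵥ ξ)

/-- The field `A⁻¹ q`. -/
def invMul (A : Plane → Matrix (Fin 2) (Fin 2) ℝ) (q : Plane → Fin 2 → ℝ) :
    Plane → Fin 2 → ℝ :=
  fun x => (A x)⁻¹ *ᵥ q x

/-- `(p, u)` solves `-div p = f` and `p = A ∇u` in `Ω`, `u = 0` on `∂Ω`, with `u ∈ H¹₀(Ω)` and
`p ∈ H(div, Ω)`. -/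
def IsExactSolution (Ω : Set Plane) (A : Plane → Matrix (Fin 2) (Fin 2) ℝ) (f : Plane → ℝ)
    (p : Plane → Fin 2 → ℝ) (u : Plane → ℝ) : Prop :=
  InL2Vec Ω p ∧ IsWeakDiv Ω p (fun x => -f x) ∧
  ∃ G, IsH10 Ω u G ∧ ∀ᵐ x ∂volume.restrict Ω, p x = A x *ᵥ G x

/-- `(ph, uh) ∈ M_h × L_h` solves the mixed finite element equations with right-hand side
`fh`. -/
structure IsDiscreteSolution (F : Family) (l : ℕ) (Ω : Set Plane) (𝒯 : Finset (Finset Plane))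
    (A : Plane → Matrix (Fin 2) (Fin 2) ℝ) (fh : Plane → ℝ)
    (ph : Plane → Fin 2 → ℝ) (uh : Plane → ℝ) : Prop where
  stress_mem : InStressSpace F l Ω 𝒯 ph
  displacement_mem : InDisplacementSpace l Ω 𝒯 uh
  constitutive : ∀ q, InStressSpace F l Ω 𝒯 q →
    (∫ x in Ω, invMul A ph x ⬝ᵥ q x) + ∫ x in Ω, weakDiv Ω q x * uh x = 0
  equilibrium : ∀ v, InDisplacementSpace l Ω 𝒯 v →
    ∫ x in Ω, weakDiv Ω ph x * v x = -∫ x in Ω, fh x * v x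

/-! ### Local curl and tangential jump -/

/-- `curl v` in the triangle `t`, in the sense of distributions in its interior. -/
def triCurl (t : Finset Plane) (v : Plane → Fin 2 → ℝ) : Plane → ℝ :=
  weakCurl (interior (hull t)) v

/-- `g ∈ L²(∂T)` is the tangential trace `v · τ_T` on `∂T`, with `τ_T` the counterclockwise unit
tangent: `∫_T (curl v) φ + ∫_T v · Curl φ = ∫_{∂T} (v · τ_T) φ` for all smooth `φ`. -/
def IsTangentialTrace (t : Finset Plane) (v : Plane → Fin 2 → ℝ) (g : Plane → ℝ) : Prop :=
  (∀ e ∈ edges t, MemLp g 2 (edgeMeasure e)) ∧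
  ∀ φ : Plane → ℝ, ContDiff ℝ ∞ φ →
    (∫ x in hull t, triCurl t v x * φ x) + ∫ x in hull t, v x ⬝ᵥ vecCurl φ x
      = ∑ e ∈ edges t, ∫ x, g x * φ x ∂edgeMeasure e

/-- On the triangle `t`, the field `v` has a curl in `L²(T)` and a tangential trace in
`L²(∂T)`. -/
def CurlRegular (t : Finset Plane) (v : Plane → Fin 2 → ℝ) : Prop :=
  (∃ c, IsWeakCurl (interior (hull t)) v c) ∧ ∃ g, IsTangentialTrace t v g

open Classical in
/-- The tangential trace `v · τ_T` on `∂T` (a representative; it is unique almost everywhere). -/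
def tangentialTrace (t : Finset Plane) (v : Plane → Fin 2 → ℝ) : Plane → ℝ :=
  if h : ∃ g, IsTangentialTrace t v g then h.choose else 0

open Classical in
/-- The jump `J(v · τ)` on the edge `e`. The counterclockwise tangents of the two triangles at an
interior edge are opposite, so the jump is (up to the sign, which depends on the choice of `τ` and
of the order of the two triangles) the sum of the two tangential traces; on a boundary edge it is
the trace from the only triangle. -/
def tangentialJump (𝒯 : Finset (Finset Plane)) (v : Plane → Fin 2 → ℝ) (e : Finset Plane) :
    Plane → ℝ :=
  fun x => ∑ t ∈ 𝒯 with e ⊆ t, tangentialTrace t v x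

/-! ### Estimator, oscillation and error -/

/-- `η²(q, T) = h_T² ‖f - f_h‖²_T + h_T² ‖curl (A⁻¹ q)‖²_T + h_T ‖J(A⁻¹ q · τ)‖²_{∂T}`. -/
def etaSqLocal (𝒯 : Finset (Finset Plane)) (A : Plane → Matrix (Fin 2) (Fin 2) ℝ)
    (f fh : Plane → ℝ) (q : Plane → Fin 2 → ℝ) (t : Finset Plane) : ℝ :=
  size t ^ 2 * (∫ x in hull t, (f x - fh x) ^ 2)
  + size t ^ 2 * (∫ x in hull t, triCurl t (invMul A q) x ^ 2)
  + size t * ∑ e ∈ edges t, ∫ x, tangentialJump 𝒯 (invMul A q) e x ^ 2 ∂edgeMeasure e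

/-- `η²(q, 𝒯)`, the square of the global stress estimator. -/
def etaSq (𝒯 : Finset (Finset Plane)) (A : Plane → Matrix (Fin 2) (Fin 2) ℝ)
    (f fh : Plane → ℝ) (q : Plane → Fin 2 → ℝ) : ℝ :=
  ∑ t ∈ 𝒯, etaSqLocal 𝒯 A f fh q t

/-- `osc²(q, T) = h_T² ‖P_n curl (A⁻¹ q)‖²_T + h_T ‖P_{n+1} J(A⁻¹ q · τ)‖²_{∂T}
+ ‖h (f - f_h)‖²_T`, where `P_m = id - Π_m`, on `T` and on each edge of `T` respectively. -/
def oscSqLocal (n : ℕ) (𝒯 : Finset (Finset Plane)) (A : Plane → Matrix (Fin 2) (Fin 2) ℝ)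
    (f fh : Plane → ℝ) (q : Plane → Fin 2 → ℝ) (t : Finset Plane) : ℝ :=
  size t ^ 2 * bestApproxErrorSq n (volume.restrict (hull t)) (triCurl t (invMul A q))
  + size t * ∑ e ∈ edges t,
      bestApproxErrorSq (n + 1) (edgeMeasure e) (tangentialJump 𝒯 (invMul A q) e)
  + size t ^ 2 * ∫ x in hull t, (f x - fh x) ^ 2

/-- `osc²(q, 𝒯)`, the square of the global oscillation. -/
def oscSq (n : ℕ) (𝒯 : Finset (Finset Plane)) (A : Plane → Matrix (Fin 2) (Fin 2) ℝ)
    (f fh : Plane → ℝ) (q : Plane → Fin 2 → ℝ) : ℝ :=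
  ∑ t ∈ 𝒯, oscSqLocal n 𝒯 A f fh q t

/-- The square of the weighted stress error, `‖A^{-1/2} (p - p_h)‖²_Ω + ‖h div (p - p_h)‖²_Ω`.
Pointwise `|A^{-1/2} ε|² = (A⁻¹ ε) · ε`, and `h = h_T` on each triangle `T`. -/
def errorSq (Ω : Set Plane) (𝒯 : Finset (Finset Plane))
    (A : Plane → Matrix (Fin 2) (Fin 2) ℝ) (p ph : Plane → Fin 2 → ℝ) : ℝ :=
  (∫ x in Ω, invMul A (p - ph) x ⬝ᵥ (p - ph) x)
  + ∑ t ∈ 𝒯, size t ^ 2 * ∫ x in hull t, weakDiv Ω (p - ph) x ^ 2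

end MixedFEM

end

open MixedFEM

/-! This is the efficiency half of a residual a posteriori estimate, proved by localization with
bump functions. Write `G = ∇u` and `v = A⁻¹ p_h`. Since `A⁻¹ p = G`, the energy error equals `∫ (G -
v) · A (G - v)`, which is at least `λ ‖G - v‖²` (`IsCoefficient.mul_integral_le`). The term with `f
- f_h` occurs on both sides, so it remains to bound curl and jump of `v` by `‖G - v‖` and the
oscillation. The link is the orthogonality of gradients to curls, `∫_S G · Curl φ = 0`, valid as
soon as the frontier of `S` meets the support of `φ` only outside `Ω`
(`IsH10.setIntegral_dotProduct_vecCurl`).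

Volume term: if `φ` is supported inside `T`, then `∫_T (curl v) φ = ∫_T (G - v) · Curl φ`. Take `φ`
to be a polynomial `P` times a bump on a ball inside `T` of radius comparable to `h_T`. On
polynomials of bounded degree all norms are equivalent, so after scaling `∫ P φ` controls `‖P‖²` on
all of `T`, and `Curl φ` costs one factor `h_T⁻¹`. This gives `exists_curl_bound` for every `P`, and
the infimum over `P` is the oscillation.

Jump term: `φ` is a polynomial on the edge `E`, extended constantly in the normal direction, times a
bump around the midpoint of `E`. There the barycentric coordinates of both endpoints are positive,
so `φ` vanishes on the other edges of the triangles at `E`, and by conformity the union of these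
triangles has no frontier point in `Ω` near the midpoint. Summing the trace identities gives `∫_E J
φ = ∑ (∫_T (curl v) φ - ∫_T (G - v) · Curl φ)` (`integral_jump_eq`). Boundary edges need no separate
treatment, because `u` is a limit of functions vanishing near `∂Ω`. The result is
`exists_jump_bound`.

Finally, a bounded number of triangles meets at each edge, so the local bounds can be summed, and
the volume bound absorbs the curl terms that the jump bound produces. -/

noncomputable section

namespace MixedFEM

/-! ### Smooth bumps and norm equivalence on polynomial spaces -/

/-- A radial smooth cutoff function, supported in the closed ball of radius `r`. -/
def bump {X : Type*} [NormedAddCommGroup X] (r : ℝ) (x : X) : ℝ :=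
  Real.smoothTransition (r ^ 2 - ‖x‖ ^ 2)

section Bump

variable {X : Type*} [NormedAddCommGroup X]

lemma bump_nonneg (r : ℝ) (x : X) : 0 ≤ bump r x := Real.smoothTransition.nonneg _

lemma bump_le_one (r : ℝ) (x : X) : bump r x ≤ 1 := Real.smoothTransition.le_one _

lemma bump_pos {r : ℝ} {x : X} (h : ‖x‖ < r) : 0 < bump r x := by
  apply Real.smoothTransition.pos_of_pos
  have := norm_nonneg x
  nlinarith

lemma bump_eq_zero {r : ℝ} (hr : 0 ≤ r) {x : X} (h : r ≤ ‖x‖) : bump r x = 0 := by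
  apply Real.smoothTransition.zero_of_nonpos
  nlinarith

lemma tsupport_bump_subset {r : ℝ} (hr : 0 ≤ r) :
    tsupport (bump r : X → ℝ) ⊆ Metric.closedBall 0 r := by
  apply closure_minimal _ Metric.isClosed_closedBall
  intro x hx
  rw [mem_closedBall_zero_iff]
  by_contra! h
  exact hx (bump_eq_zero hr h.le)

lemma contDiff_bump [InnerProductSpace ℝ X] (r : ℝ) : ContDiff ℝ ∞ (bump r : X → ℝ) :=
  Real.smoothTransition.contDiff.comp (contDiff_const.sub (contDiff_norm_sq ℝ))

lemma continuous_bump (r : ℝ) : Continuous (bump r : X → ℝ) :=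
  Real.smoothTransition.continuous.comp (by fun_prop)

lemma hasCompactSupport_bump [ProperSpace X] {r : ℝ} (hr : 0 ≤ r) :
    HasCompactSupport (bump r : X → ℝ) :=
  (isCompact_closedBall 0 r).of_isClosed_subset (isClosed_tsupport _) (tsupport_bump_subset hr)

lemma exists_fderiv_bump_bound [InnerProductSpace ℝ X] [ProperSpace X] {r : ℝ} (hr : 0 ≤ r) :
    ∃ B : ℝ, 0 ≤ B ∧ ∀ x : X, ‖fderiv ℝ (bump r : X → ℝ) x‖ ≤ B := by
  obtain ⟨B, hB⟩ := ((contDiff_bump (X := X) r).continuous_fderiv (by simp)).bounded_above_of_compact_support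
    ((hasCompactSupport_bump hr).fderiv ℝ)
  exact ⟨B, (norm_nonneg _).trans (hB 0), hB⟩

end Bump

/-- A positive definite form, homogeneous of degree two and continuous, is coercive. -/
lemma exists_coercive {d : ℕ} {Q : (Fin d → ℝ) → ℝ} (hc : Continuous Q)
    (hh : ∀ (t : ℝ) c, Q (t • c) = t ^ 2 * Q c) (hp : ∀ c, c ≠ 0 → 0 < Q c) :
    ∃ κ : ℝ, 0 < κ ∧ ∀ c, κ * ‖c‖ ^ 2 ≤ Q c := by
  by_cases hne : (Metric.sphere (0 : Fin d → ℝ) 1).Nonempty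
  · obtain ⟨c₀, hc₀, hmin⟩ := (isCompact_sphere (0 : Fin d → ℝ) 1).exists_isMinOn hne hc.continuousOn
    have h0 : c₀ ≠ 0 := by
      rintro rfl
      simp at hc₀
    refine ⟨Q c₀, hp _ h0, fun c => ?_⟩
    by_cases hcz : c = 0
    · subst hcz
      have := hh 0 0
      simp at this
      simp [this]
    · have hn : ‖c‖ ≠ 0 := norm_ne_zero_iff.mpr hcz
      have h1 : Q c₀ ≤ Q (‖c‖⁻¹ • c) := hmin (by simp [norm_smul, hn])
      rw [hh] at h1
      have : Q c = ‖c‖ ^ 2 * (‖c‖⁻¹ ^ 2 * Q c) := by field_simp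
      rw [this, mul_comm]
      gcongr
  · refine ⟨1, one_pos, fun c => ?_⟩
    have hcz : c = 0 := by
      by_contra hcz
      apply hne
      exact ⟨‖c‖⁻¹ • c, by simp [norm_smul, norm_ne_zero_iff.mpr hcz]⟩
    subst hcz
    have := hh 0 0
    simp at this
    simp [this]

/-- Equivalence of norms: in coordinates the weighted integral is a continuous quadratic form,
positive definite because the weight is positive on the open ball where `hinj` applies, hence
coercive. The basis functions and their derivatives are bounded on the compact unit ball. The
abstract form serves polynomials on the plane (for triangles) and on the line (for edges). -/
lemma exists_bound_of_finiteDimensional {X V : Type*} [NormedAddCommGroup X]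
    [InnerProductSpace ℝ X] [FiniteDimensional ℝ X] [MeasureSpace X] [BorelSpace X]
    [(volume : Measure X).IsAddHaarMeasure] [AddCommGroup V] [Module ℝ V] [FiniteDimensional ℝ V]
    (ev : V →ₗ[ℝ] (X → ℝ)) (hev : ∀ p, ContDiff ℝ ∞ (ev p)) {r : ℝ} (hr : 0 < r)
    (hinj : ∀ p, (∀ x, ‖x‖ < r → ev p x = 0) → p = 0) :
    ∃ C : ℝ, 0 < C ∧ ∀ p x, ‖x‖ ≤ 1 →
      |ev p x| ≤ C * √(∫ y, bump r y * ev p y ^ 2) ∧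
      ‖fderiv ℝ (ev p) x‖ ≤ C * √(∫ y, bump r y * ev p y ^ 2) := by
  have : ProperSpace X := FiniteDimensional.proper ℝ X
  let b := Module.finBasis ℝ V
  set d := Module.finrank ℝ V
  let comb : (Fin d → ℝ) → V := fun c => ∑ i, c i • b i
  have hcomb : ∀ c x, ev (comb c) x = ∑ i, c i * ev (b i) x := by
    intro c x
    simp [comb, Finset.sum_apply]
  let Q : (Fin d → ℝ) → ℝ := fun c => ∫ y, bump r y * ev (comb c) y ^ 2
  have hint : ∀ p, Integrable (fun y => bump r y * ev p y ^ 2) := fun p =>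
    ((continuous_bump r).mul ((hev p).continuous.pow 2)).integrable_of_hasCompactSupport
      ((hasCompactSupport_bump hr.le).mul_right)
  -- Integration over a fixed compact set makes continuity in the coefficients available.
  have hQset : ∀ c, Q c = ∫ y in Metric.closedBall 0 r, bump r y * (∑ i, c i * ev (b i) y) ^ 2 := by
    intro c
    simp only [Q, hcomb]
    symm
    apply setIntegral_eq_integral_of_forall_compl_eq_zero
    intro x hx
    rw [mem_closedBall_zero_iff, not_le] at hx
    simp [bump_eq_zero hr.le hx.le]
  have hQc : Continuous Q := by
    rw [funext hQset]
    apply continuous_parametric_integral_of_continuous _ (isCompact_closedBall _ _)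
    have h1 := continuous_bump (X := X) r
    have h2 := fun i => (hev (b i)).continuous
    fun_prop
  have hQh : ∀ (t : ℝ) c, Q (t • c) = t ^ 2 * Q c := by
    intro t c
    simp only [Q, hcomb]
    rw [← integral_const_mul]
    congr 1 with y
    simp only [Pi.smul_apply, smul_eq_mul, mul_assoc, ← Finset.mul_sum]
    ring
  have hQp : ∀ c, c ≠ 0 → 0 < Q c := by
    intro c hc
    have hnn : 0 ≤ fun y => bump r y * ev (comb c) y ^ 2 := fun y =>
      mul_nonneg (bump_nonneg _ _) (sq_nonneg _)
    have hcont : Continuous fun y => bump r y * ev (comb c) y ^ 2 :=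
      (continuous_bump r).mul ((hev _).continuous.pow 2)
    rcases (integral_nonneg hnn).lt_or_eq with h | h
    · exact h
    · exfalso
      have hz := (hcont.ae_eq_iff_eq volume continuous_zero).mp
        ((integral_eq_zero_iff_of_nonneg hnn (hint _)).mp h.symm)
      have h0 : comb c = 0 := by
        apply hinj
        intro x hx
        have := congrFun hz x
        simp only [Pi.zero_apply, mul_eq_zero] at this
        exact pow_eq_zero_iff (two_ne_zero) |>.mp (this.resolve_left (bump_pos hx).ne')
      apply hc
      funext i
      exact Fintype.linearIndependent_iff.mp b.linearIndependent c h0 i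
  obtain ⟨κ, hκ, hco⟩ := exists_coercive hQc hQh hQp
  have hM : ∀ i, ∃ M : ℝ, ∀ x : X, ‖x‖ ≤ 1 → |ev (b i) x| ≤ M ∧ ‖fderiv ℝ (ev (b i)) x‖ ≤ M := by
    intro i
    obtain ⟨M₁, h₁⟩ := (isCompact_closedBall (0 : X) 1).exists_bound_of_continuousOn
      (hev (b i)).continuous.continuousOn
    obtain ⟨M₂, h₂⟩ := (isCompact_closedBall (0 : X) 1).exists_bound_of_continuousOn
      ((hev (b i)).continuous_fderiv (by simp)).continuousOn
    refine ⟨max M₁ M₂, fun x hx => ⟨?_, ?_⟩⟩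
    · exact (h₁ x (by simpa using hx)).trans (le_max_left _ _)
    · exact (h₂ x (by simpa using hx)).trans (le_max_right _ _)
  choose M hM using hM
  have hM0 : ∀ i, 0 ≤ M i := fun i => (abs_nonneg _).trans (hM i 0 (by simp)).1
  have hS : 0 ≤ ∑ i, M i := Finset.sum_nonneg fun i _ => hM0 i
  -- The summand 1 only keeps the constant positive when all `M i` vanish.
  refine ⟨(∑ i, M i + 1) * (√κ)⁻¹, by positivity, fun p x hx => ?_⟩
  set c : Fin d → ℝ := fun i => b.repr p i with hcdef
  have hp : comb c = p := b.sum_repr p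
  have hcQ : ‖c‖ ≤ (√κ)⁻¹ * √(Q c) := by
    rw [← Real.sqrt_inv, ← Real.sqrt_mul (by positivity)]
    apply Real.le_sqrt_of_sq_le
    rw [inv_mul_eq_div, le_div_iff₀ hκ, mul_comm]
    exact hco c
  have hfin : ∀ {Y : ℝ}, Y ≤ ∑ i, ‖c‖ * M i → Y ≤ (∑ i, M i + 1) * (√κ)⁻¹ * √(Q c) := by
    intro Y hY
    refine hY.trans ?_
    rw [← Finset.mul_sum, mul_assoc, mul_comm]
    gcongr
    linarith
  have hpe : ev p = fun x => ∑ i, c i * ev (b i) x := by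
    funext x
    rw [← hcomb, hp]
  have hQp' : (∫ y, bump r y * ev p y ^ 2) = Q c := by
    simp only [Q, hp]
  rw [hQp']
  constructor
  · apply hfin
    rw [hpe]
    refine (Finset.abs_sum_le_sum_abs _ _).trans (Finset.sum_le_sum fun i _ => ?_)
    rw [abs_mul]
    exact mul_le_mul (norm_le_pi_norm c i) (hM i x hx).1 (abs_nonneg _) (norm_nonneg _)
  · apply hfin
    have hd : ∀ i, DifferentiableAt ℝ (ev (b i)) x := fun i =>
      ((hev (b i)).differentiable (by simp)).differentiableAt
    rw [hpe, fderiv_fun_sum (fun i _ => (hd i).const_mul _)]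
    refine (norm_sum_le _ _).trans (Finset.sum_le_sum fun i _ => ?_)
    rw [fderiv_const_mul (hd i), norm_smul]
    exact mul_le_mul (norm_le_pi_norm c i) (hM i x hx).2 (norm_nonneg _) (norm_nonneg _)

lemma contDiff_peval (P : MvPolynomial (Fin 2) ℝ) : ContDiff ℝ ∞ (peval P) := by
  have : peval P = fun x : Plane => ∑ d ∈ P.support, P.coeff d * ∏ i, x i ^ d i := by
    funext x
    exact MvPolynomial.eval_eq' _ _
  rw [this]
  apply ContDiff.sum
  intro d _
  apply contDiff_const.mul
  apply contDiff_prod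
  intro i _
  fun_prop

lemma exists_peval_bound (N : ℕ) {r : ℝ} (hr : 0 < r) :
    ∃ C : ℝ, 0 < C ∧ ∀ P : MvPolynomial (Fin 2) ℝ, P.totalDegree ≤ N → ∀ x : Plane, ‖x‖ ≤ 1 →
      |peval P x| ≤ C * √(∫ y : Plane, bump r y * peval P y ^ 2) ∧
      ‖fderiv ℝ (peval P) x‖ ≤ C * √(∫ y : Plane, bump r y * peval P y ^ 2) := by
  let ev : MvPolynomial.restrictTotalDegree (Fin 2) ℝ N →ₗ[ℝ] (Plane → ℝ) :=
    { toFun := fun P => peval P.1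
      map_add' := fun P Q => by
        funext x
        simp [peval]
      map_smul' := fun a P => by
        funext x
        simp [peval, MvPolynomial.smul_eval] }
  obtain ⟨C, hC, h⟩ := exists_bound_of_finiteDimensional ev (fun p => contDiff_peval p.1) hr (by
    rintro ⟨P, hP⟩ h0
    apply Subtype.ext
    change P = 0
    -- A polynomial vanishing on a product of infinite sets is zero; the square with sides `(0, r /
    -- 2)` lies in the ball of radius `r`.
    apply MvPolynomial.funext_set (fun _ => Set.Ioo 0 (r / 2))
    · intro i
      exact Set.Ioo_infinite (by positivity)
    · intro x hx
      rw [map_zero]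
      have := h0 (WithLp.toLp 2 x) (by
        have h₀ := hx 0 trivial
        have h₁ := hx 1 trivial
        rw [EuclideanSpace.norm_eq, Real.sqrt_lt' hr]
        simp only [Fin.sum_univ_two, Real.norm_eq_abs, sq_abs]
        obtain ⟨a, b⟩ := h₀
        obtain ⟨c, d⟩ := h₁
        nlinarith)
      exact this)
  exact ⟨C, hC, fun P hP x hx => h ⟨P, (MvPolynomial.mem_restrictTotalDegree _ _ _).mpr hP⟩ x hx⟩

lemma exists_eval_bound (N : ℕ) {r : ℝ} (hr : 0 < r) :
    ∃ C : ℝ, 0 < C ∧ ∀ P : Polynomial ℝ, P.natDegree ≤ N → ∀ x : ℝ, ‖x‖ ≤ 1 →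
      |P.eval x| ≤ C * √(∫ y : ℝ, bump r y * P.eval y ^ 2) ∧
      ‖fderiv ℝ (fun y => P.eval y) x‖ ≤ C * √(∫ y : ℝ, bump r y * P.eval y ^ 2) := by
  let ev : Polynomial.degreeLT ℝ (N + 1) →ₗ[ℝ] (ℝ → ℝ) :=
    { toFun := fun P x => P.1.eval x
      map_add' := fun P Q => by
        funext x
        simp
      map_smul' := fun a P => by
        funext x
        simp }
  have : FiniteDimensional ℝ (Polynomial.degreeLT ℝ (N + 1)) :=
    (Polynomial.degreeLTEquiv ℝ (N + 1)).symm.finiteDimensional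
  obtain ⟨C, hC, h⟩ := exists_bound_of_finiteDimensional ev
    (fun p => by
      have h := p.1.contDiff_aeval (𝕜 := ℝ) ∞
      simp only [Polynomial.coe_aeval_eq_eval] at h
      exact h) hr (by
    rintro ⟨P, hP⟩ h0
    apply Subtype.ext
    change P = 0
    apply Polynomial.eq_zero_of_infinite_isRoot
    refine Set.Infinite.mono ?_ (Set.Ioo_infinite (neg_lt_self hr))
    intro x hx
    exact h0 x (abs_lt.mpr hx))
  exact ⟨C, hC, fun P hP x hx => h ⟨P, by
    rw [Polynomial.mem_degreeLT]
    exact (Polynomial.degree_le_of_natDegree_le hP).trans_lt (by exact_mod_cast Nat.lt_succ_self N)⟩ x hx⟩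

/-! ### Integration by parts and orthogonality of gradients to curls -/

/-- The Cauchy-Schwarz inequality for integrals. -/
lemma abs_integral_mul_le {α : Type*} [MeasurableSpace α] {μ : Measure α} {f g : α → ℝ}
    (hf : MemLp f 2 μ) (hg : MemLp g 2 μ) :
    |∫ x, f x * g x ∂μ| ≤ √(∫ x, f x ^ 2 ∂μ) * √(∫ x, g x ^ 2 ∂μ) := by
  have h := integral_mul_norm_le_Lp_mul_Lq (μ := μ) (f := f) (g := g) Real.HolderConjugate.two_two
    (by simpa using hf) (by simpa using hg)
  simp only [← Real.sqrt_eq_rpow, Real.rpow_two, Real.norm_eq_abs, sq_abs] at h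
  refine (abs_integral_le_integral_abs).trans ?_
  simpa only [abs_mul] using h

/-- Hölder's inequality makes each component pairing with `g` continuous in `L²`, so orthogonality
passes to the limit. This transfers identities from test functions to `H¹₀`. -/
lemma eq_zero_of_tendsto_eLpNorm {α ι : Type*} [MeasurableSpace α] [Fintype ι] {μ : Measure α}
    {g F : α → ι → ℝ} {w : ℕ → α → ι → ℝ} (hg : ∀ i, MemLp (fun x => g x i) 2 μ)
    (hF : ∀ i, MemLp (fun x => F x i) 2 μ) (hw : ∀ k i, MemLp (fun x => w k x i) 2 μ)
    (hlim : ∀ i, Tendsto (fun k => eLpNorm (fun x => w k x i - F x i) 2 μ) atTop (𝓝 0))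
    (h0 : ∀ k, ∫ x, w k x ⬝ᵥ g x ∂μ = 0) : ∫ x, F x ⬝ᵥ g x ∂μ = 0 := by
  have hi : ∀ {v : α → ι → ℝ}, (∀ i, MemLp (fun x => v x i) 2 μ) → ∀ i,
      Integrable (fun x => v x i * g x i) μ := fun hv i => (hv i).integrable_mul (hg i)
  have hsum : ∀ {v : α → ι → ℝ}, (∀ i, MemLp (fun x => v x i) 2 μ) →
      ∫ x, v x ⬝ᵥ g x ∂μ = ∑ i, ∫ x, v x i * g x i ∂μ := fun hv => by
    simp only [dotProduct]
    exact integral_finsetSum _ fun i _ => hi hv i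
  have ht : ∀ i, Tendsto (fun k => ∫ x, w k x i * g x i ∂μ) atTop
      (𝓝 (∫ x, F x i * g x i ∂μ)) := by
    intro i
    rw [tendsto_iff_edist_tendsto_0]
    have hb : Tendsto (fun k => eLpNorm (fun x => w k x i - F x i) 2 μ *
        eLpNorm (fun x => g x i) 2 μ) atTop (𝓝 0) := by
      simpa using ENNReal.Tendsto.mul_const (hlim i) (Or.inr (hg i).eLpNorm_ne_top)
    refine tendsto_of_tendsto_of_tendsto_of_le_of_le tendsto_const_nhds hb (fun _ => bot_le)
      fun k => ?_
    dsimp only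
    rw [edist_eq_enorm_sub, ← integral_sub (hi (hw k) i) (hi hF i)]
    refine (enorm_integral_le_lintegral_enorm _).trans ?_
    rw [← eLpNorm_one_eq_lintegral_enorm]
    have := eLpNorm_smul_le_mul_eLpNorm (p := 2) (q := 2) (r := 1)
      (hg i).aestronglyMeasurable (((hw k i).sub (hF i)).aestronglyMeasurable)
    refine le_trans (le_of_eq ?_) this
    congr 1 with x
    simp [sub_mul]
  have h1 := tendsto_finsetSum Finset.univ fun i _ => ht i
  simp only [← hsum (hw _), h0] at h1
  rw [hsum hF]
  exact (tendsto_nhds_unique h1 tendsto_const_nhds)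

/-- The frontier of `S` misses the support of `U`, so cutting `U` off outside `S` leaves a
differentiable function with integrable derivative, and such a derivative integrates to zero over
the plane. No regularity of the boundary of `S` is involved. -/
lemma setIntegral_fderiv_eq_zero {U : Plane → ℝ} (hU : ContDiff ℝ ∞ U) (hc : HasCompactSupport U)
    {S : Set Plane} (hS : MeasurableSet S) (h : ∀ x ∈ tsupport U, S ∈ 𝓝 x ∨ Sᶜ ∈ 𝓝 x)
    (e : Plane) : ∫ x in S, fderiv ℝ U x e = 0 := by
  have hd : ∀ x, HasFDerivAt (S.indicator U) (S.indicator (fderiv ℝ U) x) x := by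
    intro x
    by_cases hx : x ∈ tsupport U
    · rcases h x hx with h | h
      · rw [Set.indicator_of_mem (mem_of_mem_nhds h)]
        exact ((hU.differentiable (by simp)) x).hasFDerivAt.congr_of_eventuallyEq
          (eventually_of_mem h fun y hy => Set.indicator_of_mem hy _)
      · rw [Set.indicator_of_notMem (mem_of_mem_nhds h)]
        exact (hasFDerivAt_const (0 : ℝ) x).congr_of_eventuallyEq
          (eventually_of_mem h fun y hy => Set.indicator_of_notMem hy _)
    · have h0 : U =ᶠ[𝓝 x] fun _ => 0 := notMem_tsupport_iff_eventuallyEq.mp hx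
      have h1 : fderiv ℝ U x = 0 := by
        rw [h0.fderiv_eq]
        simp
      have h2 : S.indicator (fderiv ℝ U) x = 0 := by
        by_cases hx : x ∈ S <;> simp [hx, h1]
      rw [h2]
      refine (hasFDerivAt_const (0 : ℝ) x).congr_of_eventuallyEq (h0.mono fun y hy => ?_)
      by_cases hy' : y ∈ S <;> simp [hy', hy]
  have hint : Integrable (fun x => S.indicator (fun x => fderiv ℝ U x e) x) := by
    refine Integrable.indicator ?_ hS
    exact ((hU.continuous_fderiv (by simp)).clm_apply continuous_const).integrable_of_hasCompactSupport
      ((hc.fderiv ℝ).comp_left (g := fun L : Plane →L[ℝ] ℝ => L e) rfl)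
  have hfd : ∀ x, fderiv ℝ (S.indicator U) x e = S.indicator (fun x => fderiv ℝ U x e) x := by
    intro x
    rw [(hd x).fderiv]
    by_cases hx : x ∈ S <;> simp [hx]
  -- Integration by parts against the constant function 1.
  have hp := integral_mul_fderiv_eq_neg_fderiv_mul_of_integrable (μ := (volume : Measure Plane))
    (f := fun _ => (1 : ℝ)) (g := S.indicator U) (v := e) (by simp)
    (by simpa only [one_mul, hfd] using hint)
    (by simpa only [one_mul] using
      (hU.continuous.integrable_of_hasCompactSupport hc).indicator hS)
    (fun _ _ => by fun_prop) (fun x _ => (hd x).differentiableAt)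
  simp only [hfd] at hp
  rw [← integral_indicator hS]
  simpa using hp

lemma contDiff_grad {φ : Plane → ℝ} (hφ : ContDiff ℝ ∞ φ) (i : Fin 2) :
    ContDiff ℝ ∞ (fun x => grad φ x i) :=
  (hφ.fderiv_right (m := ∞) (by simp)).clm_apply contDiff_const

lemma hasCompactSupport_grad {φ : Plane → ℝ} (hφ : HasCompactSupport φ) (i : Fin 2) :
    HasCompactSupport (fun x => grad φ x i) :=
  (hφ.fderiv ℝ).comp_left (g := fun L : Plane →L[ℝ] ℝ => L (EuclideanSpace.single i 1)) rfl

lemma tsupport_grad_subset (φ : Plane → ℝ) (i : Fin 2) :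
    tsupport (fun x => grad φ x i) ⊆ tsupport φ := by
  refine (closure_mono ?_).trans (tsupport_fderiv_subset ℝ (f := φ))
  intro x hx h0
  apply hx
  simp [grad, h0]

lemma contDiff_vecCurl {φ : Plane → ℝ} (hφ : ContDiff ℝ ∞ φ) (i : Fin 2) :
    ContDiff ℝ ∞ (fun x => vecCurl φ x i) := by
  fin_cases i
  · exact (contDiff_grad hφ 1).neg
  · exact contDiff_grad hφ 0

lemma hasCompactSupport_vecCurl {φ : Plane → ℝ} (hφ : HasCompactSupport φ) (i : Fin 2) :
    HasCompactSupport (fun x => vecCurl φ x i) := by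
  fin_cases i
  · exact (hasCompactSupport_grad hφ 1).neg
  · exact hasCompactSupport_grad hφ 0

lemma fderiv_grad_comm {φ : Plane → ℝ} (hφ : ContDiff ℝ ∞ φ) (x : Plane) (i j : Fin 2) :
    fderiv ℝ (fun y => grad φ y i) x (EuclideanSpace.single j 1) =
      fderiv ℝ (fun y => grad φ y j) x (EuclideanSpace.single i 1) := by
  have hd : DifferentiableAt ℝ (fderiv ℝ φ) x :=
    ((hφ.fderiv_right (m := ∞) (by simp)).differentiable (by simp)) x
  have h : ∀ e v : Plane, fderiv ℝ (fun y => fderiv ℝ φ y e) x v =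
      fderiv ℝ (fderiv ℝ φ) x v e := by
    intro e v
    rw [fderiv_clm_apply hd (by fun_prop)]
    simp
  simp only [grad, h]
  exact (hφ.contDiffAt.isSymmSndFDerivAt (by simpa using WithTop.coe_le_coe.mpr (le_top : (2 : ℕ∞) ≤ ⊤))).eq _ _

lemma memLp_of_contDiff {U : Plane → ℝ} (hU : ContDiff ℝ ∞ U) (hc : HasCompactSupport U)
    (S : Set Plane) : MemLp U 2 (volume.restrict S) :=
  (hU.continuous.memLp_of_hasCompactSupport hc).restrict S

/-- By symmetry of second derivatives, `∇w · Curl φ = ∂₂(w ∂₁φ) - ∂₁(w ∂₂φ)`, and both terms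
integrate to zero. The frontier condition is needed only where both supports meet; this is what
makes boundary edges admissible when `w` is supported in `Ω`. -/
lemma setIntegral_grad_dotProduct_vecCurl {φ w : Plane → ℝ} (hφ : ContDiff ℝ ∞ φ)
    (hw : ContDiff ℝ ∞ w) (hwc : HasCompactSupport w)
    {S : Set Plane} (hS : MeasurableSet S)
    (h : ∀ x ∈ tsupport φ, x ∈ tsupport w → S ∈ 𝓝 x ∨ Sᶜ ∈ 𝓝 x) :
    ∫ x in S, grad w x ⬝ᵥ vecCurl φ x = 0 := by
  have hU : ∀ i, ContDiff ℝ ∞ (fun x => w x * grad φ x i) := fun i => hw.mul (contDiff_grad hφ i)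
  have hUc : ∀ i, HasCompactSupport (fun x => w x * grad φ x i) := fun i => hwc.mul_right
  have hz : ∀ i e, ∫ x in S, fderiv ℝ (fun x => w x * grad φ x i) x e = 0 := fun i e =>
    setIntegral_fderiv_eq_zero (hU i) (hUc i) hS (fun x hx => h x
      (tsupport_grad_subset φ i (tsupport_mul_subset_right hx)) (tsupport_mul_subset_left hx)) e
  have hint : ∀ i e, IntegrableOn (fun x => fderiv ℝ (fun x => w x * grad φ x i) x e) S := fun i e =>
    (((hU i).continuous_fderiv (by simp)).clm_apply
      continuous_const).integrable_of_hasCompactSupport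
      (((hUc i).fderiv ℝ).comp_left (g := fun L : Plane →L[ℝ] ℝ => L e) rfl) |>.integrableOn
  have hpt : ∀ x, grad w x ⬝ᵥ vecCurl φ x =
      fderiv ℝ (fun x => w x * grad φ x 0) x (EuclideanSpace.single 1 1) -
      fderiv ℝ (fun x => w x * grad φ x 1) x (EuclideanSpace.single 0 1) := by
    intro x
    have hd : ∀ i, DifferentiableAt ℝ (fun y => grad φ y i) x := fun i =>
      (contDiff_grad hφ i).differentiable (by simp) x
    have hdw : DifferentiableAt ℝ w x := hw.differentiable (by simp) x
    rw [fderiv_fun_mul hdw (hd 0), fderiv_fun_mul hdw (hd 1)]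
    have := fderiv_grad_comm hφ x 0 1
    simp only [dotProduct, Fin.sum_univ_two, vecCurl, add_apply, smul_apply, smul_eq_mul, this]

    simp [grad]
    ring
  simp only [hpt]
  rw [integral_sub (hint _ _) (hint _ _), hz, hz, sub_zero]

/-- The gradient of a function in `H¹₀(Ω)` is orthogonal to `Curl φ` on any set `S` whose boundary
meets the support of `φ` outside `Ω` only. -/
lemma IsH10.setIntegral_dotProduct_vecCurl {Ω : Set Plane} {u : Plane → ℝ} {G : Plane → Fin 2 → ℝ}
    (hG : IsH10 Ω u G) {φ : Plane → ℝ} (hφ : ContDiff ℝ ∞ φ) (hφc : HasCompactSupport φ)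
    {S : Set Plane} (hS : MeasurableSet S) (hle : volume.restrict S ≤ volume.restrict Ω)
    (h : ∀ x ∈ tsupport φ, x ∈ Ω → S ∈ 𝓝 x ∨ Sᶜ ∈ 𝓝 x) :
    ∫ x in S, G x ⬝ᵥ vecCurl φ x = 0 := by
  obtain ⟨-, hG2, w, hw, -, hlim⟩ := hG
  refine eq_zero_of_tendsto_eLpNorm (w := fun k x => grad (w k) x)
    (fun i => memLp_of_contDiff (contDiff_vecCurl hφ i) (hasCompactSupport_vecCurl hφc i) S)
    (fun i => (hG2 i).mono_measure hle)
    (fun k i => memLp_of_contDiff (contDiff_grad (hw k).smooth i)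
      (hasCompactSupport_grad (hw k).compact i) S) (fun i => ?_) fun k => ?_
  · exact tendsto_of_tendsto_of_tendsto_of_le_of_le tendsto_const_nhds (hlim i)
      (fun _ => bot_le) fun k => eLpNorm_mono_measure _ hle
  · exact setIntegral_grad_dotProduct_vecCurl hφ (hw k).smooth (hw k).compact hS
      fun x hx hxw => h x hx ((hw k).support_subset hxw)

/-! ### Geometry of triangles -/

/-- The affine functions `lam v`, `v ∈ t`, are the barycentric coordinates of the triangle `t`. -/
structure IsBarycentric (t : Finset Plane) (lam : Plane → Plane →ᵃ[ℝ] ℝ) : Prop where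
  apply_self : ∀ v ∈ t, lam v v = 1
  apply_of_ne : ∀ v ∈ t, ∀ w ∈ t, v ≠ w → lam v w = 0
  hull_eq : hull t = {x | ∀ v ∈ t, 0 ≤ lam v x}
  interior_eq : interior (hull t) = {x | ∀ v ∈ t, 0 < lam v x}
  sum_eq_one : ∀ x, ∑ v ∈ t, lam v x = 1
  sum_smul : ∀ x, ∑ v ∈ t, lam v x • v = x

/-- The shape regularity of a single nondegenerate triangle. -/
structure IsRegularTriangle (c : ℝ) (t : Finset Plane) : Prop where
  card_eq : t.card = 3
  nondegenerate : AffineIndependent ℝ ((↑) : t → Plane)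
  le_volume : c⁻¹ * size t ^ 2 ≤ volume.real (hull t)
  volume_le : volume.real (hull t) ≤ c * size t ^ 2

lemma isCompact_hull (t : Finset Plane) : IsCompact (hull t) :=
  Set.Finite.isCompact_convexHull (𝕜 := ℝ) t.finite_toSet

lemma isClosed_hull (t : Finset Plane) : IsClosed (hull t) := (isCompact_hull t).isClosed

lemma measurableSet_hull (t : Finset Plane) : MeasurableSet (hull t) :=
  (isClosed_hull t).measurableSet

lemma volume_hull_lt_top (t : Finset Plane) : volume (hull t) < ⊤ :=
  (isCompact_hull t).measure_lt_top

lemma mem_hull {t : Finset Plane} {v : Plane} (h : v ∈ t) : v ∈ hull t :=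
  subset_convexHull ℝ _ h

lemma dist_le_size {t : Finset Plane} {x y : Plane} (hx : x ∈ hull t) (hy : y ∈ hull t) :
    dist x y ≤ size t :=
  Metric.dist_le_diam_of_mem (isCompact_hull t).isBounded hx hy

lemma interior_hull_ae_eq (t : Finset Plane) : interior (hull t) =ᵐ[volume] hull t :=
  interior_ae_eq_of_null_frontier ((convex_convexHull ℝ _).addHaar_frontier _)

lemma restrict_interior_hull (t : Finset Plane) :
    volume.restrict (interior (hull t)) = volume.restrict (hull t) :=
  Measure.restrict_congr_set (interior_hull_ae_eq t)

lemma exists_isBarycentric {t : Finset Plane} (hc : t.card = 3)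
    (ha : AffineIndependent ℝ ((↑) : t → Plane)) : ∃ lam, IsBarycentric t lam := by
  have htop : affineSpan ℝ (Set.range ((↑) : t → Plane)) = ⊤ := by
    rw [ha.affineSpan_eq_top_iff_card_eq_finrank_add_one]
    simp [hc]
  let b : AffineBasis t ℝ Plane := ⟨(↑), ha, htop⟩
  have hb : ∀ i, b i = i.1 := fun _ => rfl
  have hr : Set.range b = (t : Set Plane) := Subtype.range_coe
  have hl : ∀ v (h : v ∈ t), (if h : v ∈ t then b.coord ⟨v, h⟩ else 0) = b.coord ⟨v, h⟩ :=
    fun v h => dif_pos h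
  -- The value at points outside `t` is immaterial, since `IsBarycentric` speaks of vertices only.
  refine ⟨fun v => if h : v ∈ t then b.coord ⟨v, h⟩ else 0, ?_, ?_, ?_, ?_, ?_, ?_⟩
  · intro v hv
    rw [hl v hv]
    exact b.coord_apply_eq ⟨v, hv⟩
  · intro v hv w hw hne
    rw [hl v hv]
    exact b.coord_apply_ne (i := ⟨v, hv⟩) (j := ⟨w, hw⟩) (by simpa using hne)
  · have := b.convexHull_eq_nonneg_coord
    rw [hr] at this
    rw [hull, this]
    ext x
    refine ⟨fun h v hv => ?_, fun h i => ?_⟩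
    · rw [hl v hv]
      exact h _
    · have := h i.1 i.2
      rwa [hl i.1 i.2] at this
  · have := b.interior_convexHull
    rw [hr] at this
    rw [hull, this]
    ext x
    refine ⟨fun h v hv => ?_, fun h i => ?_⟩
    · rw [hl v hv]
      exact h _
    · have := h i.1 i.2
      rwa [hl i.1 i.2] at this
  · intro x
    rw [← b.sum_coord_apply_eq_one x, ← Finset.sum_coe_sort t]
    exact Finset.sum_congr rfl fun i _ => by rw [hl i.1 i.2]
  · intro x
    conv_rhs => rw [← b.linear_combination_coord_eq_self x, ]
    rw [← Finset.sum_coe_sort t]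
    exact Finset.sum_congr rfl fun i _ => by rw [hl i.1 i.2, hb]

/-- Twice the signed area of the triangle spanned by `u` and `v`. -/
def cross (u v : Plane) : ℝ := u 0 * v 1 - u 1 * v 0

lemma abs_cross_le (u v : Plane) : |cross u v| ≤ ‖u‖ * ‖v‖ := by
  rw [EuclideanSpace.norm_eq, EuclideanSpace.norm_eq, ← Real.sqrt_mul (by positivity)]
  apply Real.abs_le_sqrt
  simp only [Fin.sum_univ_two, Real.norm_eq_abs, sq_abs, cross]
  nlinarith [sq_nonneg (u 0 * v 0 + u 1 * v 1)]

lemma volume_parallelepiped (u v : Plane) :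
    volume (parallelepiped ![u, v]) = ENNReal.ofReal |cross u v| := by
  have h := Measure.addHaar_parallelepiped (EuclideanSpace.basisFun (Fin 2) ℝ).toBasis ![u, v]
  rw [(EuclideanSpace.basisFun (Fin 2) ℝ).addHaar_eq_volume] at h
  rw [h, Module.Basis.det_apply, Matrix.det_fin_two]
  simp [Module.Basis.toMatrix_apply, cross, mul_comm]

lemma exists_eq_insert {t : Finset Plane} (hc : t.card = 3) {v : Plane} (hv : v ∈ t) :
    ∃ p q, p ∈ t ∧ q ∈ t ∧ v ≠ p ∧ v ≠ q ∧ p ≠ q ∧ t = {v, p, q} := by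
  have h2 : (t.erase v).card = 2 := by rw [Finset.card_erase_of_mem hv, hc]
  obtain ⟨p, q, hpq, h⟩ := Finset.card_eq_two.mp h2
  have hp : p ∈ t.erase v := by simp [h]
  have hq : q ∈ t.erase v := by simp [h]
  rw [Finset.mem_erase] at hp hq
  exact ⟨p, q, hp.2, hq.2, hp.1.symm, hq.1.symm, hpq, by rw [← h, Finset.insert_erase hv]⟩

namespace IsBarycentric

variable {t : Finset Plane} {lam : Plane → Plane →ᵃ[ℝ] ℝ}

lemma sub_eq (hl : IsBarycentric t lam) {v p q : Plane} (ht : t = {v, p, q}) (h1 : v ≠ p)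
    (h2 : v ≠ q) (h3 : p ≠ q) (x : Plane) :
    x - p = lam q x • (q - p) + lam v x • (v - p) := by
  have hs := hl.sum_eq_one x
  have hx := hl.sum_smul x
  subst ht
  rw [Finset.sum_insert (by simp [h1, h2]), Finset.sum_pair h3] at hs hx
  nth_rewrite 1 [← hx]
  have : lam p x = 1 - lam v x - lam q x := by linarith
  rw [this]
  module

/-- Cramer's rule for the coordinate at `v`. -/
lemma mul_cross_eq (hl : IsBarycentric t lam) {v p q : Plane} (ht : t = {v, p, q}) (h1 : v ≠ p)
    (h2 : v ≠ q) (h3 : p ≠ q) (x : Plane) :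
    lam v x * cross (q - p) (v - p) = cross (q - p) (x - p) := by
  rw [hl.sub_eq ht h1 h2 h3 x]
  simp [cross]
  ring

/-- The triangle lies in the parallelogram spanned by two of its sides; the lost factor 2 does not
matter. -/
lemma volume_le_cross (hl : IsBarycentric t lam) {v p q : Plane} (ht : t = {v, p, q}) (h1 : v ≠ p)
    (h2 : v ≠ q) (h3 : p ≠ q) : volume.real (hull t) ≤ |cross (q - p) (v - p)| := by
  have hsub : hull t ⊆ (p + ·) '' parallelepiped ![q - p, v - p] := by
    intro x hx
    refine ⟨x - p, ?_, by simp⟩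
    rw [mem_parallelepiped_iff]
    rw [hl.hull_eq] at hx
    have hs := hl.sum_eq_one x
    rw [ht, Finset.sum_insert (by simp [h1, h2]), Finset.sum_pair h3] at hs
    have hv := hx v (by simp [ht])
    have hp := hx p (by simp [ht])
    have hq := hx q (by simp [ht])
    refine ⟨![lam q x, lam v x], ⟨?_, ?_⟩, ?_⟩
    · intro i
      fin_cases i
      · exact hq
      · exact hv
    · intro i
      fin_cases i
      · change lam q x ≤ 1
        linarith
      · change lam v x ≤ 1
        linarith
    · rw [hl.sub_eq ht h1 h2 h3 x]
      simp
  rw [Measure.real]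
  refine ENNReal.toReal_le_of_le_ofReal (abs_nonneg _) ?_
  refine (measure_mono hsub).trans ?_
  rw [Set.image_add_left, measure_preimage_add, volume_parallelepiped]

lemma eq_zero_of_mem (hl : IsBarycentric t lam) {v : Plane} (hv : v ∈ t) {s : Set Plane}
    (hs : s ⊆ t) (hvs : v ∉ s) {x : Plane} (hx : x ∈ convexHull ℝ s) : lam v x = 0 := by
  have hconv : Convex ℝ {x | lam v x = 0} := by
    have := (convex_singleton (0 : ℝ)).affine_preimage (lam v)
    exact this
  refine convexHull_min (fun w hw => ?_) hconv hx
  exact hl.apply_of_ne v hv w (hs hw) fun h => hvs (h ▸ hw)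

end IsBarycentric

namespace IsRegularTriangle

variable {c : ℝ} {t : Finset Plane}

lemma size_pos (ht : IsRegularTriangle c t) : 0 < size t := by
  obtain ⟨a, ha⟩ := Finset.card_pos.mp (by rw [ht.card_eq]; norm_num : 0 < t.card)
  obtain ⟨p, q, hp, -, hne, -⟩ := exists_eq_insert ht.card_eq ha
  exact (dist_pos.mpr hne).trans_le (dist_le_size (mem_hull ha) (mem_hull hp))

lemma volume_pos (ht : IsRegularTriangle c t) : 0 < volume.real (hull t) := by
  have htop : affineSpan ℝ (Set.range ((↑) : t → Plane)) = ⊤ := by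
    rw [ht.nondegenerate.affineSpan_eq_top_iff_card_eq_finrank_add_one]
    simp [ht.card_eq]
  have hne : (interior (hull t)).Nonempty := by
    rw [hull, interior_convexHull_nonempty_iff_affineSpan_eq_top, ← htop]
    congr 1
    exact Subtype.range_coe.symm
  exact ENNReal.toReal_pos (((isOpen_interior.measure_pos volume hne).trans_le
    (measure_mono interior_subset)).ne') (volume_hull_lt_top t).ne

lemma const_pos (ht : IsRegularTriangle c t) : 0 < c := by
  have h := ht.volume_pos.trans_le ht.volume_le
  exact pos_of_mul_pos_left h (by positivity)

lemma sq_size_le_cross (ht : IsRegularTriangle c t) {v p q : Plane} (h : t = {v, p, q})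
    (h1 : v ≠ p) (h2 : v ≠ q) (h3 : p ≠ q) : size t ^ 2 ≤ c * |cross (q - p) (v - p)| := by
  obtain ⟨lam, hl⟩ := exists_isBarycentric ht.card_eq ht.nondegenerate
  have := ht.le_volume.trans (hl.volume_le_cross h h1 h2 h3)
  rwa [inv_mul_le_iff₀ ht.const_pos] at this

/-- The gradient of a barycentric coordinate has size at most `c / h`: in Cramer's rule the
numerator is at most `h * dist x y`, while shape regularity makes the determinant at least `h ^ 2 /
c`. -/
lemma abs_coord_sub_le (ht : IsRegularTriangle c t) {lam : Plane → Plane →ᵃ[ℝ] ℝ}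
    (hl : IsBarycentric t lam) {v : Plane} (hv : v ∈ t) (x y : Plane) :
    |lam v x - lam v y| ≤ c / size t * dist x y := by
  obtain ⟨p, q, hp, hq, h1, h2, h3, h⟩ := exists_eq_insert ht.card_eq hv
  have hD := ht.sq_size_le_cross h h1 h2 h3
  have hs := ht.size_pos
  set D := cross (q - p) (v - p)
  have hxy : |lam v x - lam v y| * |D| ≤ size t * dist x y := by
    rw [← abs_mul, sub_mul, hl.mul_cross_eq h h1 h2 h3, hl.mul_cross_eq h h1 h2 h3]
    have : cross (q - p) (x - p) - cross (q - p) (y - p) = cross (q - p) (x - y) := by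
      simp [cross]
      ring
    rw [this]
    refine (abs_cross_le _ _).trans ?_
    rw [← dist_eq_norm, ← dist_eq_norm]
    gcongr
    exact dist_le_size (mem_hull hq) (mem_hull hp)
  rw [div_mul_eq_mul_div, le_div_iff₀ hs]
  refine le_of_mul_le_mul_right ?_ hs
  calc |lam v x - lam v y| * size t * size t
      = |lam v x - lam v y| * size t ^ 2 := by ring
    _ ≤ |lam v x - lam v y| * (c * |D|) := by gcongr
    _ = c * (|lam v x - lam v y| * |D|) := by ring
    _ ≤ c * (size t * dist x y) := by
        have := ht.const_pos
        gcongr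
    _ = c * dist x y * size t := by ring

/-- Shape regularity and twice the area give `h ^ 2 ≤ c * |cross| ≤ c * dist a b * h`; division by
`h` makes every edge comparable to the diameter. -/
lemma size_le_mul_dist (ht : IsRegularTriangle c t) {a b : Plane} (ha : a ∈ t) (hb : b ∈ t)
    (hab : a ≠ b) : size t ≤ c * dist a b := by
  obtain ⟨p, q, hp, hq, h1, h2, h3, h⟩ := exists_eq_insert ht.card_eq ha
  have key : ∀ b v, b ∈ t → v ∈ t → a ≠ b → v ≠ a → v ≠ b → t = {v, a, b} →
      size t ≤ c * dist a b := by
    intro b v hb hv hab h1 h2 h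
    have hD := ht.sq_size_le_cross h h1 h2 hab
    have hs := ht.size_pos
    refine le_of_mul_le_mul_right ?_ hs
    calc size t * size t = size t ^ 2 := by ring
      _ ≤ c * (‖b - a‖ * ‖v - a‖) := hD.trans (by
          have := ht.const_pos
          gcongr
          exact abs_cross_le _ _)
      _ ≤ c * (dist a b * size t) := by
          have := ht.const_pos
          rw [← dist_eq_norm, ← dist_eq_norm, dist_comm b a]
          gcongr
          exact dist_le_size (mem_hull hv) (mem_hull ha)
      _ = _ := by ring
  have hb' := hb
  rw [h] at hb'
  simp only [Finset.mem_insert, Finset.mem_singleton] at hb'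
  rcases hb' with rfl | rfl | rfl
  · exact absurd rfl hab
  · exact key b q hb hq hab h2.symm h3.symm (by rw [h]; ext; simp; tauto)
  · exact key b p hb hp hab h1.symm h3 (by rw [h]; ext; simp; tauto)

end IsRegularTriangle

/-- The relative radius of the balls on which the bumps live. -/
def relRadius (c : ℝ) : ℝ := 1 / (4 * (c + 1))

lemma relRadius_pos {c : ℝ} (hc : 0 < c) : 0 < relRadius c := by
  unfold relRadius
  positivity

lemma relRadius_le {c : ℝ} (hc : 0 < c) : relRadius c ≤ 1 / 4 := by
  unfold relRadius
  gcongr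
  linarith

/-- With the Lipschitz constant `c / h`, a barycentric coordinate varies by at most `1 / 4` at
distance up to `relRadius c * h`. This is less than its value `1 / 3` at the barycenter and `1 / 2`
at the midpoint of an edge through the vertex. -/
lemma mul_relRadius_le {c : ℝ} (hc : 0 < c) : c * relRadius c ≤ 1 / 4 := by
  unfold relRadius
  rw [mul_one_div, div_le_div_iff₀ (by positivity) (by positivity)]
  linarith

namespace IsRegularTriangle

variable {c : ℝ} {t : Finset Plane}

/-- A triangle contains a ball of radius comparable to its size. -/
lemma exists_closedBall_subset (ht : IsRegularTriangle c t) :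
    ∃ z ∈ hull t, Metric.closedBall z (relRadius c * size t) ⊆ interior (hull t) := by
  obtain ⟨lam, hl⟩ := exists_isBarycentric ht.card_eq ht.nondegenerate
  obtain ⟨a, b, d, hab, had, hbd, h⟩ := Finset.card_eq_three.mp ht.card_eq
  have hs := ht.size_pos
  have hc := ht.const_pos
  have ha : a ∈ t := by simp [h]
  have hb : b ∈ t := by simp [h]
  have hd : d ∈ t := by simp [h]
  -- The barycenter, built from affine combinations of two points so that affine maps can be
  -- evaluated on it.
  set z : Plane := AffineMap.lineMap (midpoint ℝ a b) d (1 / 3 : ℝ)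
  have hz : ∀ v ∈ t, lam v z = 1 / 3 := by
    intro v hv
    simp only [z, AffineMap.apply_lineMap, AffineMap.map_midpoint]
    have hv' := hv
    rw [h] at hv'
    simp only [Finset.mem_insert, Finset.mem_singleton] at hv'
    rcases hv' with rfl | rfl | rfl
    · rw [hl.apply_self _ ha, hl.apply_of_ne _ ha _ hb hab, hl.apply_of_ne _ ha _ hd had]
      simp [AffineMap.lineMap_apply, midpoint_eq_smul_add]
      norm_num
    · rw [hl.apply_self _ hb, hl.apply_of_ne _ hb _ ha hab.symm, hl.apply_of_ne _ hb _ hd hbd]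
      simp [AffineMap.lineMap_apply, midpoint_eq_smul_add]
      norm_num
    · rw [hl.apply_self _ hd, hl.apply_of_ne _ hd _ ha had.symm, hl.apply_of_ne _ hd _ hb hbd.symm]
      simp [AffineMap.lineMap_apply]
  refine ⟨z, ?_, fun x hx => ?_⟩
  · rw [hl.hull_eq]
    intro v hv
    rw [hz v hv]
    norm_num
  · rw [hl.interior_eq]
    intro v hv
    have h1 := ht.abs_coord_sub_le hl hv x z
    rw [hz v hv] at h1
    have h2 : c / size t * dist x z ≤ 1 / 4 := by
      calc c / size t * dist x z ≤ c / size t * (relRadius c * size t) := by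
            gcongr
            exact hx
        _ = c * relRadius c := by field_simp
        _ ≤ _ := mul_relRadius_le hc
    have := (abs_le.mp (h1.trans h2)).1
    linarith

/-- The barycentric coordinates of the endpoints of an edge are positive close to its midpoint. -/
lemma coord_pos (ht : IsRegularTriangle c t) {lam : Plane → Plane →ᵃ[ℝ] ℝ}
    (hl : IsBarycentric t lam) {a b : Plane} (ha : a ∈ t) (hb : b ∈ t) (hab : a ≠ b) {x : Plane}
    (hx : dist x (midpoint ℝ a b) ≤ relRadius c * dist a b) : 0 < lam a x := by
  have hs := ht.size_pos
  have hc := ht.const_pos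
  have hm : lam a (midpoint ℝ a b) = 1 / 2 := by
    rw [AffineMap.map_midpoint, hl.apply_self _ ha, hl.apply_of_ne _ ha _ hb hab]
    simp [midpoint_eq_smul_add]
  have h1 := ht.abs_coord_sub_le hl ha x (midpoint ℝ a b)
  rw [hm] at h1
  have h2 : c / size t * dist x (midpoint ℝ a b) ≤ 1 / 4 := by
    calc c / size t * dist x (midpoint ℝ a b) ≤ c / size t * (relRadius c * size t) := by
          have := relRadius_pos hc
          gcongr
          refine hx.trans ?_
          gcongr
          exact dist_le_size (mem_hull ha) (mem_hull hb)
      _ = c * relRadius c := by field_simp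
      _ ≤ _ := mul_relRadius_le hc
  have := (abs_le.mp (h1.trans h2)).1
  linarith

end IsRegularTriangle

/-! ### Geometry of triangulations -/

namespace IsTriangulation

variable {Ω : Set Plane} {𝒯 : Finset (Finset Plane)} {c : ℝ}

lemma isRegularTriangle (h : IsTriangulation Ω 𝒯) (hs : ShapeRegular c 𝒯) {t : Finset Plane}
    (ht : t ∈ 𝒯) : IsRegularTriangle c t :=
  ⟨h.card_eq t ht, h.nondegenerate t ht, (hs t ht).1, (hs t ht).2⟩

lemma hull_ae_le (h : IsTriangulation Ω 𝒯) {t : Finset Plane} (ht : t ∈ 𝒯) :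
    hull t ≤ᵐ[volume] Ω := by
  refine (interior_hull_ae_eq t).symm.le.trans (Eventually.of_forall ?_)
  rw [h.domain_eq]
  exact interior_mono (Set.subset_biUnion_of_mem (u := fun t => hull t) ht)

lemma restrict_hull_le (h : IsTriangulation Ω 𝒯) {t : Finset Plane} (ht : t ∈ 𝒯) :
    volume.restrict (hull t) ≤ volume.restrict Ω :=
  Measure.restrict_mono_ae (h.hull_ae_le ht)

/-- A point of `s ∩ t` has vanishing coordinate at the vertices of `t` that are not in `s`. -/
lemma coord_eq_zero (h : IsTriangulation Ω 𝒯) {s t : Finset Plane} (hs : s ∈ 𝒯) (ht : t ∈ 𝒯)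
    {lam : Plane → Plane →ᵃ[ℝ] ℝ} (hl : IsBarycentric t lam) {v : Plane} (hv : v ∈ t) (hvs : v ∉ s)
    {x : Plane} (hxs : x ∈ hull s) (hxt : x ∈ hull t) : lam v x = 0 := by
  have hx : x ∈ hull s ∩ hull t := ⟨hxs, hxt⟩
  rw [h.conforming s hs t ht] at hx
  exact hl.eq_zero_of_mem hv Set.inter_subset_right (fun hv' => hvs hv'.1) hx

/-- Some vertex of `t` is not in `s`, and its coordinate vanishes on the intersection. The
intersection thus lies in the frontier of `t`, which is null by convexity. -/
lemma aedisjoint (h : IsTriangulation Ω 𝒯) {s t : Finset Plane} (hs : s ∈ 𝒯) (ht : t ∈ 𝒯)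
    (hne : s ≠ t) : AEDisjoint volume (hull s) (hull t) := by
  obtain ⟨v, hv, hvs⟩ : ∃ v ∈ t, v ∉ s := by
    by_contra! hsub
    exact hne (Finset.eq_of_subset_of_card_le hsub (by rw [h.card_eq s hs, h.card_eq t ht])).symm
  obtain ⟨lam, hl⟩ := exists_isBarycentric (h.card_eq t ht) (h.nondegenerate t ht)
  refine measure_mono_null (fun x hx => ?_)
    ((convex_convexHull ℝ (t : Set Plane)).addHaar_frontier volume)
  change x ∈ frontier (hull t)
  rw [(isClosed_hull t).frontier_eq]
  refine ⟨hx.2, fun hint => ?_⟩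
  rw [hl.interior_eq] at hint
  exact (hint v hv).ne' (h.coord_eq_zero hs ht hl hv hvs hx.1 hx.2)

lemma restrict_biUnion_hull (h : IsTriangulation Ω 𝒯) {N : Finset (Finset Plane)} (hN : N ⊆ 𝒯) :
    volume.restrict (⋃ t ∈ N, hull t) = ∑ t ∈ N, volume.restrict (hull t) := by
  induction N using Finset.induction_on with
  | empty => simp
  | insert a N ha ih =>
    rw [Finset.set_biUnion_insert, Finset.sum_insert ha, ← ih
      ((Finset.subset_insert a N).trans hN)]
    refine Measure.restrict_union₀ ?_ (Finset.measurableSet_biUnion N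
      fun t _ => measurableSet_hull t).nullMeasurableSet
    change volume (hull a ∩ ⋃ t ∈ N, hull t) = 0
    rw [Set.inter_iUnion₂]
    refine (measure_biUnion_null_iff N.countable_toSet).mpr fun t ht => ?_
    exact h.aedisjoint (hN (Finset.mem_insert_self a N)) (hN (Finset.mem_insert_of_mem ht))
      fun hat => ha (hat ▸ ht)

lemma restrict_biUnion_hull_le (h : IsTriangulation Ω 𝒯) {N : Finset (Finset Plane)}
    (hN : N ⊆ 𝒯) : volume.restrict (⋃ t ∈ N, hull t) ≤ volume.restrict Ω := by
  apply Measure.restrict_mono_ae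
  have : ∀ t ∈ N, ∀ᵐ x, x ∈ hull t → x ∈ Ω := fun t ht => h.hull_ae_le (hN ht)
  filter_upwards [(eventually_all_finset N).mpr this] with x hx hxN
  obtain ⟨t, ht, hxt⟩ := Set.mem_iUnion₂.mp hxN
  exact hx t ht hxt

lemma setIntegral_biUnion_hull (h : IsTriangulation Ω 𝒯) {N : Finset (Finset Plane)}
    (hN : N ⊆ 𝒯) {F : Plane → ℝ} (hF : IntegrableOn F Ω) :
    ∫ x in ⋃ t ∈ N, hull t, F x = ∑ t ∈ N, ∫ x in hull t, F x := by
  rw [h.restrict_biUnion_hull hN]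
  exact integral_finsetSum_measure fun t ht => Integrable.mono_measure hF
    (h.restrict_hull_le (hN ht))

lemma sum_setIntegral_le (h : IsTriangulation Ω 𝒯) {F : Plane → ℝ} (hF : IntegrableOn F Ω)
    (h0 : ∀ x, 0 ≤ F x) : ∑ t ∈ 𝒯, ∫ x in hull t, F x ≤ ∫ x in Ω, F x := by
  rw [← h.setIntegral_biUnion_hull subset_rfl hF]
  exact integral_mono_measure (h.restrict_biUnion_hull_le subset_rfl)
    (Eventually.of_forall h0) hF

/-- The number of triangles that share an edge is bounded in terms of the shape regularity. -/
lemma card_filter_le (h : IsTriangulation Ω 𝒯) (hs : ShapeRegular c 𝒯) {a b : Plane}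
    (hab : a ≠ b) {N : Finset (Finset Plane)} (hN : N ⊆ 𝒯) (ha : ∀ t ∈ N, a ∈ t)
    (hb : ∀ t ∈ N, b ∈ t) : (N.card : ℝ) ≤ Real.pi * c ^ 3 ∨ N = ∅ := by
  -- The sign of `c` is known only in the presence of a triangle, whence the alternative in the
  -- conclusion.
  rcases N.eq_empty_or_nonempty with rfl | ⟨t₀, ht₀⟩
  · exact Or.inr rfl
  left
  have hc : 0 < c := (h.isRegularTriangle hs (hN ht₀)).const_pos
  have hd : 0 < dist a b := dist_pos.mpr hab
  -- Packing argument: these triangles overlap in null sets, lie in a disc of area `π c² |ab|²`, and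
  -- each has area at least `c⁻¹ |ab|²`.
  have hsub : (⋃ t ∈ N, hull t) ⊆ Metric.closedBall a (c * dist a b) := by
    intro x hx
    obtain ⟨t, ht, hxt⟩ := Set.mem_iUnion₂.mp hx
    exact (dist_le_size hxt (mem_hull (ha t ht))).trans
      ((h.isRegularTriangle hs (hN ht)).size_le_mul_dist (ha t ht) (hb t ht) hab)
  have hvol : ∑ t ∈ N, volume.real (hull t) ≤ Real.pi * (c * dist a b) ^ 2 := by
    have h1 : ∑ t ∈ N, volume (hull t) ≤ volume (Metric.closedBall a (c * dist a b)) := by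
      refine le_trans (le_of_eq ?_) (measure_mono hsub)
      have := congrArg (fun μ : Measure Plane => μ Set.univ) (h.restrict_biUnion_hull hN)
      simpa using this.symm
    rw [EuclideanSpace.volume_closedBall_fin_two] at h1
    simp only [Measure.real]
    rw [← ENNReal.toReal_sum fun t _ => (volume_hull_lt_top t).ne]
    refine (ENNReal.toReal_mono (by finiteness) h1).trans (le_of_eq ?_)
    rw [ENNReal.toReal_mul, ENNReal.toReal_pow, ENNReal.toReal_ofReal (by positivity)]
    simp [mul_comm, Real.pi_pos.le]
  have hlow : N.card * (c⁻¹ * dist a b ^ 2) ≤ ∑ t ∈ N, volume.real (hull t) := by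
    rw [← nsmul_eq_mul]
    refine Finset.card_nsmul_le_sum N _ _ fun t ht => ?_
    refine le_trans ?_ (h.isRegularTriangle hs (hN ht)).le_volume
    gcongr
    exact dist_le_size (mem_hull (ha t ht)) (mem_hull (hb t ht))
  have h2 := hlow.trans hvol
  refine le_of_mul_le_mul_right ?_ (by positivity : 0 < c⁻¹ * dist a b ^ 2)
  refine h2.trans (le_of_eq ?_)
  field_simp

/-- Close to the midpoint of an edge, the union of the triangles that contain the edge has no
boundary points in `Ω`. -/
lemma mem_nhds_or_compl_mem_nhds (h : IsTriangulation Ω 𝒯) (hs : ShapeRegular c 𝒯) {a b : Plane}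
    (hab : a ≠ b) {x : Plane} (hx : dist x (midpoint ℝ a b) ≤ relRadius c * dist a b)
    (hxΩ : x ∈ Ω) :
    (⋃ t ∈ 𝒯.filter ({a, b} ⊆ ·), hull t) ∈ 𝓝 x ∨ (⋃ t ∈ 𝒯.filter ({a, b} ⊆ ·), hull t)ᶜ ∈ 𝓝 x := by
  by_cases hxS : x ∈ ⋃ t ∈ 𝒯.filter ({a, b} ⊆ ·), hull t
  · left
    obtain ⟨t, ht, hxt⟩ := Set.mem_iUnion₂.mp hxS
    rw [Finset.mem_filter] at ht
    obtain ⟨lam, hl⟩ := exists_isBarycentric (h.card_eq t ht.1) (h.nondegenerate t ht.1)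
    have hreg := h.isRegularTriangle hs ht.1
    have ha : a ∈ t := ht.2 (by simp)
    have hb : b ∈ t := ht.2 (by simp)
    have hpa := hreg.coord_pos hl ha hb hab hx
    have hpb := hreg.coord_pos hl hb ha hab.symm (by rwa [midpoint_comm, dist_comm b a])
    -- The triangles without the full edge form a closed set. It misses `x`: by conformity, in such
    -- a triangle the coordinate of `a` or of `b` would vanish at `x`. Hence all points of `Ω` near
    -- `x` lie in triangles containing the edge.
    have hclosed : IsClosed (⋃ s ∈ 𝒯.filter (¬ {a, b} ⊆ ·), hull s) :=
      Set.Finite.isClosed_biUnion (Finset.finite_toSet _) fun s _ => isClosed_hull s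
    have hnot : x ∉ ⋃ s ∈ 𝒯.filter (¬ {a, b} ⊆ ·), hull s := by
      intro hx'
      obtain ⟨s, hs', hxs⟩ := Set.mem_iUnion₂.mp hx'
      rw [Finset.mem_filter] at hs'
      apply hs'.2
      intro v hv
      by_contra hvs
      simp only [Finset.mem_insert, Finset.mem_singleton] at hv
      rcases hv with rfl | rfl
      · exact hpa.ne' (h.coord_eq_zero hs'.1 ht.1 hl ha hvs hxs hxt)
      · exact hpb.ne' (h.coord_eq_zero hs'.1 ht.1 hl hb hvs hxs hxt)
    have hΩ : Ω ∈ 𝓝 x := by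
      rw [h.domain_eq] at hxΩ ⊢
      exact isOpen_interior.mem_nhds hxΩ
    filter_upwards [hΩ, hclosed.isOpen_compl.mem_nhds hnot] with y hy hy'
    rw [h.domain_eq] at hy
    obtain ⟨s, hs', hys⟩ := Set.mem_iUnion₂.mp (interior_subset hy)
    refine Set.mem_iUnion₂.mpr ⟨s, Finset.mem_filter.mpr ⟨hs', ?_⟩, hys⟩
    by_contra hne
    exact hy' (Set.mem_iUnion₂.mpr ⟨s, Finset.mem_filter.mpr ⟨hs', hne⟩, hys⟩)
  · right
    exact (Set.Finite.isClosed_biUnion (Finset.finite_toSet _)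
      fun s _ => isClosed_hull s).isOpen_compl.mem_nhds hxS

end IsTriangulation

/-! ### The length measure on an edge -/

lemma hull_pair (a b : Plane) : hull {a, b} = segment ℝ a b := by
  rw [hull, Finset.coe_pair, convexHull_pair]

lemma edgeMeasure_univ (a b : Plane) : edgeMeasure {a, b} Set.univ = edist a b := by
  rw [edgeMeasure, Measure.restrict_apply_univ, hull_pair, hausdorffMeasure_segment]

instance (a b : Plane) : IsFiniteMeasure (edgeMeasure {a, b}) :=
  ⟨by rw [edgeMeasure_univ]; exact edist_lt_top a b⟩

lemma ae_edgeMeasure_mem (e : Finset Plane) : ∀ᵐ x ∂edgeMeasure e, x ∈ hull e :=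
  ae_restrict_mem (measurableSet_hull e)

lemma midpoint_add_mem_hull_iff {a b : Plane} (hab : a ≠ b) (s : ℝ) :
    midpoint ℝ a b + s • (b - a) ∈ hull {a, b} ↔ s ∈ Set.Icc (-(1 / 2) : ℝ) (1 / 2) := by
  have hba : b - a ≠ 0 := sub_ne_zero.mpr hab.symm
  have hm : ∀ s : ℝ, midpoint ℝ a b + s • (b - a) = a + (s + 1 / 2) • (b - a) := by
    intro s
    rw [midpoint_eq_smul_add]
    norm_num
    module
  rw [hull_pair, segment_eq_image', hm]
  constructor
  · rintro ⟨θ, hθ, hx⟩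
    have : θ = s + 1 / 2 := smul_left_injective ℝ hba (add_left_cancel hx)
    constructor <;> linarith [hθ.1, hθ.2]
  · intro hs
    exact ⟨s + 1 / 2, ⟨by linarith [hs.1], by linarith [hs.2]⟩, rfl⟩

lemma exists_eq_of_mem_hull_pair {a b x : Plane} (hx : x ∈ hull {a, b}) :
    ∃ s : ℝ, |s| ≤ 1 / 2 ∧ x = midpoint ℝ a b + s • (b - a) := by
  rw [hull_pair, segment_eq_image'] at hx
  obtain ⟨θ, hθ, rfl⟩ := hx
  refine ⟨θ - 1 / 2, abs_le.mpr ⟨by linarith [hθ.1], by linarith [hθ.2]⟩, ?_⟩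
  rw [midpoint_eq_smul_add]
  norm_num
  module

/-- Parametrization of integrals over an edge, for functions supported in its interior. -/
lemma integral_edgeMeasure {a b : Plane} (hab : a ≠ b) {F : Plane → ℝ}
    (hF : ∀ s : ℝ, 1 / 2 < |s| → F (midpoint ℝ a b + s • (b - a)) = 0) :
    ∫ x, F x ∂edgeMeasure {a, b} = dist a b * ∫ s : ℝ, F (midpoint ℝ a b + s • (b - a)) := by
  have hd : 0 < dist a b := dist_pos.mpr hab
  have hn : ‖b - a‖ = dist a b := by rw [dist_comm, dist_eq_norm]
  -- Arc length parametrization of the line, starting at the midpoint; as an isometry it carries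
  -- Lebesgue measure to the one-dimensional Hausdorff measure on its range.
  let i : ℝ → Plane := fun s => midpoint ℝ a b + (s / dist a b) • (b - a)
  have hi : Isometry i := by
    refine Isometry.of_dist_eq fun s r => ?_
    simp only [i, dist_add_left]
    rw [dist_eq_norm, ← sub_smul, norm_smul, hn, ← sub_div, norm_div, Real.norm_eq_abs,
      Real.norm_eq_abs, abs_of_pos hd, Real.dist_eq]
    field_simp
  have hme : MeasurableEmbedding i := hi.isClosedEmbedding.measurableEmbedding
  have hsub : hull {a, b} ⊆ Set.range i := by
    intro x hx
    obtain ⟨s, -, rfl⟩ := exists_eq_of_mem_hull_pair hx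
    exact ⟨s * dist a b, by simp only [i]; field_simp⟩
  have hmeas : edgeMeasure {a, b} = (Measure.map i volume).restrict (hull {a, b}) := by
    rw [← hausdorffMeasure_real, hi.map_hausdorffMeasure (Or.inl zero_le_one),
      Measure.restrict_restrict (measurableSet_hull _), Set.inter_eq_left.mpr hsub, edgeMeasure]
  rw [hmeas, hme.setIntegral_map, setIntegral_eq_integral_of_forall_compl_eq_zero]
  · have := Measure.integral_comp_div (fun s : ℝ => F (midpoint ℝ a b + s • (b - a))) (dist a b)
    simp only [i]
    rw [this, abs_of_pos hd, smul_eq_mul]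
  · intro s hs
    apply hF
    by_contra! hle
    exact hs ((midpoint_add_mem_hull_iff hab _).mpr (abs_le.mp hle))

/-! ### Localized functions -/

/-- The function `g`, localized by a bump and transplanted to the ball of radius `r * ℓ`
around `z`. -/
def localized (r ℓ : ℝ) (z : Plane) (g : Plane → ℝ) (x : Plane) : ℝ :=
  bump r (ℓ⁻¹ • (x - z)) * g (ℓ⁻¹ • (x - z))

lemma contDiff_localized {r ℓ : ℝ} {z : Plane} {g : Plane → ℝ} (hg : ContDiff ℝ ∞ g) :
    ContDiff ℝ ∞ (localized r ℓ z g) := by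
  have h : ContDiff ℝ ∞ fun x : Plane => ℓ⁻¹ • (x - z) := by fun_prop
  exact ((contDiff_bump r).comp h).mul (hg.comp h)

lemma tsupport_localized_subset {r ℓ : ℝ} (hr : 0 ≤ r) (hℓ : 0 < ℓ) {z : Plane} {g : Plane → ℝ} :
    tsupport (localized r ℓ z g) ⊆ Metric.closedBall z (r * ℓ) := by
  apply closure_minimal _ Metric.isClosed_closedBall
  intro x hx
  by_contra hlt
  apply hx
  rw [Metric.mem_closedBall, not_le, dist_eq_norm] at hlt
  have : r ≤ ‖ℓ⁻¹ • (x - z)‖ := by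
    rw [norm_smul, norm_inv, Real.norm_of_nonneg hℓ.le, inv_mul_eq_div, le_div_iff₀ hℓ]
    exact hlt.le
  simp [localized, bump_eq_zero hr this]

lemma hasCompactSupport_localized {r ℓ : ℝ} (hr : 0 ≤ r) (hℓ : 0 < ℓ) {z : Plane}
    {g : Plane → ℝ} : HasCompactSupport (localized r ℓ z g) :=
  (isCompact_closedBall z (r * ℓ)).of_isClosed_subset (isClosed_tsupport _)
    (tsupport_localized_subset hr hℓ)

/-- Bounds on `g` are required on the unit ball only, as a polynomial admits no others in general;
beyond it the bump vanishes because `r ≤ 1`. -/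
lemma abs_localized_le {r ℓ M : ℝ} (hr : 0 ≤ r) (hr1 : r ≤ 1) {z : Plane} {g : Plane → ℝ}
    (hg : ∀ y, ‖y‖ ≤ 1 → |g y| ≤ M) (x : Plane) : |localized r ℓ z g x| ≤ M := by
  have hM : 0 ≤ M := (abs_nonneg _).trans (hg 0 (by simp))
  rw [localized]
  set y := ℓ⁻¹ • (x - z)
  by_cases hy : ‖y‖ ≤ 1
  · rw [abs_mul, abs_of_nonneg (bump_nonneg r y)]
    exact (mul_le_mul (bump_le_one r y) (hg y hy) (abs_nonneg _) zero_le_one).trans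
      (one_mul M).le
  · rw [bump_eq_zero hr (hr1.trans (not_le.mp hy).le)]
    simpa using hM

lemma norm_fderiv_bump_mul_le {r B M : ℝ} (hr : 0 ≤ r) (hr1 : r ≤ 1)
    (hB : ∀ y : Plane, ‖fderiv ℝ (bump r : Plane → ℝ) y‖ ≤ B) {g : Plane → ℝ}
    (hgc : ContDiff ℝ ∞ g) (hg : ∀ y, ‖y‖ ≤ 1 → |g y| ≤ M)
    (hg' : ∀ y, ‖y‖ ≤ 1 → ‖fderiv ℝ g y‖ ≤ M) (y : Plane) :
    ‖fderiv ℝ (fun y => bump r y * g y) y‖ ≤ (1 + B) * M := by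
  have hM : 0 ≤ M := (abs_nonneg _).trans (hg 0 (by simp))
  have hB0 : 0 ≤ B := (norm_nonneg _).trans (hB 0)
  by_cases hy : ‖y‖ ≤ 1
  · rw [fderiv_fun_mul ((contDiff_bump r).differentiable (by simp) y)
      (hgc.differentiable (by simp) y)]
    refine (norm_add_le _ _).trans ?_
    rw [norm_smul, norm_smul, Real.norm_of_nonneg (bump_nonneg r y), Real.norm_eq_abs]
    calc bump r y * ‖fderiv ℝ g y‖ + |g y| * ‖fderiv ℝ (bump r) y‖ ≤ 1 * M + M * B := by
          gcongr
          · exact bump_le_one r y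
          · exact hg' y hy
          · exact hg y hy
          · exact hB y
      _ = _ := by ring
  · have h0 : (fun y => bump r y * g y) =ᶠ[𝓝 y] fun _ => 0 := by
      filter_upwards [(isOpen_lt continuous_const continuous_norm).mem_nhds (not_le.mp hy)]
        with w hw
      rw [bump_eq_zero hr (hr1.trans (le_of_lt hw)), zero_mul]
    rw [h0.fderiv_eq]
    simp
    positivity

lemma norm_fderiv_localized_le {r ℓ B M : ℝ} (hr : 0 ≤ r) (hr1 : r ≤ 1) (hℓ : 0 < ℓ)
    (hB : ∀ y : Plane, ‖fderiv ℝ (bump r : Plane → ℝ) y‖ ≤ B) {z : Plane} {g : Plane → ℝ}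
    (hgc : ContDiff ℝ ∞ g) (hg : ∀ y, ‖y‖ ≤ 1 → |g y| ≤ M)
    (hg' : ∀ y, ‖y‖ ≤ 1 → ‖fderiv ℝ g y‖ ≤ M) (x : Plane) :
    ‖fderiv ℝ (localized r ℓ z g) x‖ ≤ (1 + B) * M / ℓ := by
  have hd : DifferentiableAt ℝ (fun y => bump r y * g y) (ℓ⁻¹ • (x - z)) :=
    (((contDiff_bump r).mul hgc).differentiable (by simp)) _
  have h1 : HasFDerivAt (fun x : Plane => ℓ⁻¹ • (x - z))
      (ℓ⁻¹ • ContinuousLinearMap.id ℝ Plane) x :=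
    ((hasFDerivAt_id x).sub_const z).const_smul ℓ⁻¹
  have h2 : HasFDerivAt (localized r ℓ z g)
      ((fderiv ℝ (fun y => bump r y * g y) (ℓ⁻¹ • (x - z))).comp
        (ℓ⁻¹ • ContinuousLinearMap.id ℝ Plane)) x :=
    HasFDerivAt.comp (g := fun y => bump r y * g y) x hd.hasFDerivAt h1
  rw [h2.fderiv, ContinuousLinearMap.comp_smul, ContinuousLinearMap.comp_id, norm_smul, norm_inv,
    Real.norm_of_nonneg hℓ.le, inv_mul_eq_div]
  gcongr
  exact norm_fderiv_bump_mul_le hr hr1 hB hgc hg hg' _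

lemma abs_vecCurl_le (φ : Plane → ℝ) (x : Plane) (i : Fin 2) : |vecCurl φ x i| ≤ ‖fderiv ℝ φ x‖ := by
  have h : ∀ j, |grad φ x j| ≤ ‖fderiv ℝ φ x‖ := fun j => by
    simpa [grad] using (fderiv ℝ φ x).le_opNorm (EuclideanSpace.single j 1)
  fin_cases i
  · simpa [vecCurl] using h 1
  · simpa [vecCurl] using h 0

lemma integral_localized_mul_comp (r ℓ : ℝ) (z : Plane) (g f : Plane → ℝ) :
    ∫ x, localized r ℓ z g x * f (ℓ⁻¹ • (x - z)) = ℓ ^ 2 * ∫ y, bump r y * g y * f y := by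
  simp only [localized]
  rw [integral_sub_right_eq_self (fun x => bump r (ℓ⁻¹ • x) * g (ℓ⁻¹ • x) * f (ℓ⁻¹ • x)) z,
    Measure.integral_comp_inv_smul volume (fun y : Plane => bump r y * g y * f y) ℓ]
  simp

/-! ### Integral estimates -/

lemma integrable_dotProduct_self {α : Type*} [MeasurableSpace α] {μ : Measure α}
    {e : α → Fin 2 → ℝ} (he : ∀ i, MemLp (fun x => e x i) 2 μ) :
    Integrable (fun x => e x ⬝ᵥ e x) μ := by
  simp only [dotProduct, Fin.sum_univ_two]
  exact ((he 0).integrable_mul (he 0)).add ((he 1).integrable_mul (he 1))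

lemma integral_sq_le_two_mul {α : Type*} [MeasurableSpace α] {μ : Measure α} {f g : α → ℝ}
    (hf : MemLp f 2 μ) (hg : MemLp g 2 μ) :
    ∫ x, f x ^ 2 ∂μ ≤ 2 * ∫ x, (f x - g x) ^ 2 ∂μ + 2 * ∫ x, g x ^ 2 ∂μ := by
  have h1 : Integrable (fun x => 2 * (f x - g x) ^ 2) μ := (hf.sub hg).integrable_sq.const_mul 2
  have h2 : Integrable (fun x => 2 * g x ^ 2) μ := hg.integrable_sq.const_mul 2
  rw [← integral_const_mul, ← integral_const_mul, ← integral_add h1 h2]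
  refine integral_mono hf.integrable_sq (h1.add h2) fun x => ?_
  simp only
  nlinarith [sq_nonneg (f x - 2 * g x)]

lemma integral_sub_mul {α : Type*} [MeasurableSpace α] {μ : Measure α} {f g φ : α → ℝ}
    (hf : MemLp f 2 μ) (hg : MemLp g 2 μ) (hφ : MemLp φ 2 μ) :
    ∫ x, (f x - g x) * φ x ∂μ = ∫ x, f x * φ x ∂μ - ∫ x, g x * φ x ∂μ := by
  simp only [sub_mul]
  exact integral_sub (hf.integrable_mul hφ) (hg.integrable_mul hφ)

lemma dotProduct_self_nonneg {ι : Type*} [Fintype ι] (w : ι → ℝ) : 0 ≤ w ⬝ᵥ w :=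
  Finset.sum_nonneg fun _ _ => mul_self_nonneg _

section Estimates

variable {α : Type*} [MeasurableSpace α] {μ : Measure α} [IsFiniteMeasure μ]

lemma sqrt_integral_sq_le {g : α → ℝ} {M : ℝ} (hM : 0 ≤ M) (hb : ∀ᵐ x ∂μ, |g x| ≤ M) :
    √(∫ x, g x ^ 2 ∂μ) ≤ M * √(μ.real Set.univ) := by
  rw [← Real.sqrt_sq hM, ← Real.sqrt_mul (by positivity)]
  apply Real.sqrt_le_sqrt
  rw [mul_comm, ← smul_eq_mul, ← integral_const]
  exact integral_mono_of_nonneg (Eventually.of_forall fun x => sq_nonneg _) (integrable_const _)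
    (hb.mono fun x hx => sq_le_sq' (by linarith [(abs_le.mp hx).1]) (abs_le.mp hx).2)

lemma abs_integral_mul_le_of_bound {f g : α → ℝ} {M : ℝ} (hM : 0 ≤ M) (hf : MemLp f 2 μ)
    (hg : MemLp g 2 μ) (hb : ∀ᵐ x ∂μ, |g x| ≤ M) :
    |∫ x, f x * g x ∂μ| ≤ M * √(μ.real Set.univ) * √(∫ x, f x ^ 2 ∂μ) := by
  refine (abs_integral_mul_le hf hg).trans ?_
  rw [mul_comm]
  gcongr
  exact sqrt_integral_sq_le hM hb

lemma abs_integral_dotProduct_le_of_bound {e g : α → Fin 2 → ℝ} {M : ℝ} (hM : 0 ≤ M)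
    (he : ∀ i, MemLp (fun x => e x i) 2 μ) (hg : ∀ i, MemLp (fun x => g x i) 2 μ)
    (hb : ∀ i, ∀ᵐ x ∂μ, |g x i| ≤ M) :
    |∫ x, e x ⬝ᵥ g x ∂μ| ≤ 2 * M * √(μ.real Set.univ) * √(∫ x, e x ⬝ᵥ e x ∂μ) := by
  have hcomp : ∀ i, |∫ x, e x i * g x i ∂μ| ≤
      M * √(μ.real Set.univ) * √(∫ x, e x ⬝ᵥ e x ∂μ) := by
    intro i
    refine (abs_integral_mul_le_of_bound hM (he i) (hg i) (hb i)).trans ?_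
    refine mul_le_mul_of_nonneg_left (Real.sqrt_le_sqrt ?_) (by positivity)
    refine integral_mono (he i).integrable_sq (integrable_dotProduct_self he) fun x => ?_
    simp only [dotProduct, Fin.sum_univ_two]
    fin_cases i
    · change e x 0 ^ 2 ≤ _
      nlinarith [sq_nonneg (e x 1)]
    · change e x 1 ^ 2 ≤ _
      nlinarith [sq_nonneg (e x 0)]
  have hsum : ∫ x, e x ⬝ᵥ g x ∂μ = ∫ x, e x 0 * g x 0 ∂μ + ∫ x, e x 1 * g x 1 ∂μ := by
    simp only [dotProduct, Fin.sum_univ_two]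
    exact integral_add ((he 0).integrable_mul (hg 0)) ((he 1).integrable_mul (hg 1))
  rw [hsum]
  refine (abs_add_le _ _).trans ((add_le_add (hcomp 0) (hcomp 1)).trans (le_of_eq ?_))
  ring

end Estimates

/-! ### The curl estimate -/

lemma totalDegree_bind₁_le {N : ℕ} {P : MvPolynomial (Fin 2) ℝ} (hP : P.totalDegree ≤ N)
    {f : Fin 2 → MvPolynomial (Fin 2) ℝ} (hf : ∀ i, (f i).totalDegree ≤ 1) :
    (MvPolynomial.bind₁ f P).totalDegree ≤ N := by
  rw [MvPolynomial.bind₁, MvPolynomial.aeval_def, MvPolynomial.eval₂_eq']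
  refine MvPolynomial.totalDegree_finsetSum_le fun d hd => ?_
  refine (MvPolynomial.totalDegree_mul _ _).trans ?_
  rw [MvPolynomial.algebraMap_eq, MvPolynomial.totalDegree_C, zero_add]
  refine (MvPolynomial.totalDegree_finsetProd _ _).trans ?_
  refine le_trans ?_ ((MvPolynomial.le_totalDegree hd).trans hP)
  rw [Finsupp.sum_fintype _ _ fun _ => rfl]
  refine Finset.sum_le_sum fun i _ => (MvPolynomial.totalDegree_pow _ _).trans ?_
  exact (Nat.mul_le_mul_left _ (hf i)).trans (mul_one _).le

/-- Polynomials of bounded degree are stable under scaling and translation. -/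
lemma exists_peval_scaled {N : ℕ} {P : MvPolynomial (Fin 2) ℝ} (hP : P.totalDegree ≤ N)
    (z : Plane) (ℓ : ℝ) : ∃ R : MvPolynomial (Fin 2) ℝ, R.totalDegree ≤ N ∧
      ∀ y : Plane, peval R y = peval P (z + ℓ • y) := by
  refine ⟨MvPolynomial.bind₁ (fun i => MvPolynomial.C (z i) +
    MvPolynomial.C ℓ * MvPolynomial.X i) P, totalDegree_bind₁_le hP fun i => ?_, fun y => ?_⟩
  · refine (MvPolynomial.totalDegree_add _ _).trans (max_le (by simp) ?_)
    refine (MvPolynomial.totalDegree_mul _ _).trans ?_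
    simp
  · rw [peval, peval, ← MvPolynomial.aeval_eq_eval, MvPolynomial.aeval_bind₁]
    simp only [MvPolynomial.aeval_eq_eval]
    simp

lemma sqrt_volume_hull_le {c : ℝ} {t : Finset Plane} (ht : IsRegularTriangle c t) :
    √(volume.real (hull t)) ≤ √c * size t := by
  rw [← Real.sqrt_sq ht.size_pos.le, ← Real.sqrt_mul ht.const_pos.le]
  exact Real.sqrt_le_sqrt ht.volume_le

lemma memLp_peval (P : MvPolynomial (Fin 2) ℝ) (t : Finset Plane) :
    MemLp (peval P) 2 (volume.restrict (hull t)) := by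
  have hfin : IsFiniteMeasure (volume.restrict (hull t)) :=
    ⟨by rw [Measure.restrict_apply_univ]; exact volume_hull_lt_top t⟩
  have hc := (contDiff_peval P).continuous
  obtain ⟨B, hB⟩ := (isCompact_hull t).exists_bound_of_continuousOn hc.continuousOn
  exact MemLp.of_bound hc.aestronglyMeasurable B
    ((ae_restrict_mem (measurableSet_hull t)).mono hB)

/-- The volume residual is bounded by the error and the oscillation. -/
lemma exists_curl_bound (N : ℕ) (c : ℝ) : ∃ C : ℝ, 0 < C ∧ ∀ t, IsRegularTriangle c t →
    ∀ (v G : Plane → Fin 2 → ℝ) (d : Plane → ℝ), InL2Vec (hull t) v → InL2Vec (hull t) G →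
    IsWeakCurl (interior (hull t)) v d →
    (∀ φ, IsTestFunction (interior (hull t)) φ → ∫ x in hull t, G x ⬝ᵥ vecCurl φ x = 0) →
    ∀ P : MvPolynomial (Fin 2) ℝ, P.totalDegree ≤ N →
      size t ^ 2 * ∫ x in hull t, d x ^ 2 ≤ C * (size t ^ 2 * (∫ x in hull t, (d x - peval P x) ^ 2)
        + ∫ x in hull t, (G x - v x) ⬝ᵥ (G x - v x)) := by
  -- For `c ≤ 0` there are no regular triangles and any constant will do.
  by_cases hc : 0 < c
  swap
  · exact ⟨1, one_pos, fun t ht => absurd ht.const_pos hc⟩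
  set r := relRadius c
  have hr : 0 < r := relRadius_pos hc
  have hr1 : r ≤ 1 := (relRadius_le hc).trans (by norm_num)
  obtain ⟨C₀, hC₀, hbound⟩ := exists_peval_bound N hr
  obtain ⟨B, hB0, hB⟩ := exists_fderiv_bump_bound (X := Plane) hr.le
  -- The summand 1 comes from the approximation term, and `2 * (1 + B)` from the two components of
  -- `Curl φ`.
  set K := C₀ * √c * (1 + 2 * (1 + B))
  refine ⟨2 + 4 * (C₀ * √c * K) ^ 2, by positivity, ?_⟩
  intro t ht v G d hv hG hd hGo P hP
  obtain ⟨z, hz, hball⟩ := ht.exists_closedBall_subset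
  set h := size t
  have hh : 0 < h := ht.size_pos
  -- `R` is `P` in the rescaled variable `y = (x - z) / h`, for which the constants do not depend on
  -- the triangle.
  obtain ⟨R, hR, hRP⟩ := exists_peval_scaled hP z h
  have hRP' : ∀ x, peval R (h⁻¹ • (x - z)) = peval P x := by
    intro x
    rw [hRP, smul_smul, mul_inv_cancel₀ hh.ne', one_smul, add_sub_cancel]
  set Q := ∫ y : Plane, bump r y * peval R y ^ 2 with hQdef
  have hQ0 : 0 ≤ Q := integral_nonneg fun y => mul_nonneg (bump_nonneg _ _) (sq_nonneg _)
  set M := C₀ * √Q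
  have hM : 0 ≤ M := by positivity
  have hb0 : ∀ y : Plane, ‖y‖ ≤ 1 → |peval R y| ≤ M := fun y hy => (hbound R hR y hy).1
  have hb1 : ∀ y : Plane, ‖y‖ ≤ 1 → ‖fderiv ℝ (peval R) y‖ ≤ M := fun y hy => (hbound R hR y hy).2
  set φ := localized r h z (peval R)
  have hφ : IsTestFunction (interior (hull t)) φ :=
    ⟨contDiff_localized (contDiff_peval R), hasCompactSupport_localized hr.le hh,
      (tsupport_localized_subset hr.le hh).trans hball⟩
  have hφM : ∀ x, |φ x| ≤ M := abs_localized_le hr.le hr1 hb0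
  have hφM' : ∀ x i, |vecCurl φ x i| ≤ (1 + B) * M / h := fun x i =>
    (abs_vecCurl_le φ x i).trans (norm_fderiv_localized_le hr.le hr1 hh hB (contDiff_peval R) hb0
      hb1 x)
  have hfin : IsFiniteMeasure (volume.restrict (hull t)) :=
    ⟨by rw [Measure.restrict_apply_univ]; exact volume_hull_lt_top t⟩
  have hV : √((volume.restrict (hull t)).real Set.univ) ≤ √c * h := by
    rw [measureReal_restrict_apply_univ]
    exact sqrt_volume_hull_le ht
  have hφ2 : MemLp φ 2 (volume.restrict (hull t)) := memLp_of_contDiff hφ.smooth hφ.compact _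
  have hφC : ∀ i, MemLp (fun x => vecCurl φ x i) 2 (volume.restrict (hull t)) := fun i =>
    memLp_of_contDiff (contDiff_vecCurl hφ.smooth i) (hasCompactSupport_vecCurl hφ.compact i) _
  obtain ⟨hd2, hdφ⟩ := hd
  rw [InL2, restrict_interior_hull] at hd2
  have hdφ := hdφ φ hφ
  rw [restrict_interior_hull] at hdφ
  have hP2 := memLp_peval P t
  set a := √(∫ x in hull t, (G x - v x) ⬝ᵥ (G x - v x))
  set b := √(∫ x in hull t, (d x - peval P x) ^ 2)
  have hdot : ∀ {w : Plane → Fin 2 → ℝ}, InL2Vec (hull t) w →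
      IntegrableOn (fun x => w x ⬝ᵥ vecCurl φ x) (hull t) := by
    intro w hw
    simp only [dotProduct, Fin.sum_univ_two]
    exact ((hw 0).integrable_mul (hφC 0)).add ((hw 1).integrable_mul (hφC 1))
  -- The key identity: the curl of `v` acts on `φ` as the error `G - v` acts on `Curl φ`.
  have e1 : ∫ x in hull t, d x * φ x = ∫ x in hull t, (G x - v x) ⬝ᵥ vecCurl φ x := by
    simp only [sub_dotProduct]
    rw [integral_sub (hdot hG) (hdot hv), hGo φ hφ, hdφ]
    ring
  have e2 : h ^ 2 * Q = ∫ x in hull t, peval P x * φ x := by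
    rw [setIntegral_eq_integral_of_forall_compl_eq_zero]
    · rw [hQdef]
      simp only [pow_two (peval R _), ← mul_assoc]
      rw [← integral_localized_mul_comp r h z (peval R) (peval R)]
      simp only [hRP', mul_comm (peval P _)]
      rfl
    · intro x hx
      have : φ x = 0 := image_eq_zero_of_notMem_tsupport fun hx' =>
        hx (interior_subset (hφ.support_subset hx'))
      rw [this, mul_zero]
  have e3 : h ^ 2 * Q = (∫ x in hull t, (G x - v x) ⬝ᵥ vecCurl φ x) -
      ∫ x in hull t, (d x - peval P x) * φ x := by
    rw [e2, ← e1, integral_sub_mul hd2 hP2 hφ2]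
    ring
  have i1 := abs_integral_dotProduct_le_of_bound (e := fun x => G x - v x) (g := vecCurl φ)
    (by positivity : 0 ≤ (1 + B) * M / h)
    (fun i => (hG i).sub (hv i)) hφC (fun i => Eventually.of_forall fun x => hφM' x i)
  have i2 := abs_integral_mul_le_of_bound (f := fun x => d x - peval P x) hM (hd2.sub hP2) hφ2
    (Eventually.of_forall hφM)
  have ha0 : 0 ≤ a := Real.sqrt_nonneg _
  have hb0' : 0 ≤ b := Real.sqrt_nonneg _
  have j1 : h ^ 2 * Q ≤ √Q * (K * (a + h * b)) := by
    calc h ^ 2 * Q ≤ 2 * ((1 + B) * M / h) * (√c * h) * a + M * (√c * h) * b := by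
          rw [e3]
          refine (le_abs_self _).trans ((abs_sub _ _).trans (add_le_add (i1.trans ?_)
            (i2.trans ?_)))
          · gcongr
          · gcongr
      _ = √Q * (C₀ * √c * (2 * (1 + B)) * a + C₀ * √c * 1 * (h * b)) := by
          simp only [M]
          field_simp
      _ ≤ √Q * (C₀ * √c * (1 + 2 * (1 + B)) * a + C₀ * √c * (1 + 2 * (1 + B)) * (h * b)) := by
          gcongr
          · linarith
          · linarith
      _ = _ := by
          simp only [K]
          ring
  -- One factor `√Q` is cancelled; for `Q = 0` the claim is trivial.
  have j2 : h ^ 2 * √Q ≤ K * (a + h * b) := by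
    rcases (Real.sqrt_nonneg Q).eq_or_lt with h0 | h0
    · rw [← h0]
      have : 0 ≤ K := by positivity
      simpa using by positivity
    · refine le_of_mul_le_mul_left ?_ h0
      refine le_trans (le_of_eq ?_) j1
      nth_rewrite 3 [← Real.mul_self_sqrt hQ0]
      ring
  -- The triangle lies in the ball of radius `h` around `z`, which rescales to the unit ball; so the
  -- sup bound `M` for `R` holds for `P` on all of `hull t`.
  have j3 : ∫ x in hull t, peval P x ^ 2 ≤ (C₀ * √c * (h * √Q)) ^ 2 := by
    rw [← Real.sqrt_le_left (by positivity)]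
    refine (sqrt_integral_sq_le hM ?_).trans ?_
    · filter_upwards [ae_restrict_mem (measurableSet_hull t)] with x hx
      rw [← hRP']
      apply hb0
      rw [norm_smul, norm_inv, Real.norm_of_nonneg hh.le, ← dist_eq_norm, inv_mul_le_one₀ hh]
      exact dist_le_size hx hz
    · calc M * √((volume.restrict (hull t)).real Set.univ) ≤ M * (√c * h) := by gcongr
        _ = _ := by
          simp only [M]
          ring
  have j4 := integral_sq_le_two_mul hd2 hP2
  have ha2 : a ^ 2 = ∫ x in hull t, (G x - v x) ⬝ᵥ (G x - v x) :=
    Real.sq_sqrt (integral_nonneg fun x => dotProduct_self_nonneg _)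
  have hb2 : b ^ 2 = ∫ x in hull t, (d x - peval P x) ^ 2 :=
    Real.sq_sqrt (integral_nonneg fun x => sq_nonneg _)
  rw [← ha2, ← hb2]
  rw [← hb2] at j4
  have hK : 0 ≤ K := by positivity
  calc h ^ 2 * ∫ x in hull t, d x ^ 2 ≤ h ^ 2 * (2 * b ^ 2 + 2 * (C₀ * √c * (h * √Q)) ^ 2) := by
        gcongr
        linarith
    _ = 2 * (h * b) ^ 2 + 2 * (C₀ * √c) ^ 2 * (h ^ 2 * √Q) ^ 2 := by ring
    _ ≤ 2 * (h * b) ^ 2 + 2 * (C₀ * √c) ^ 2 * (K * (a + h * b)) ^ 2 := by gcongr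
    _ = 2 * (h * b) ^ 2 + 2 * (C₀ * √c * K) ^ 2 * (a + h * b) ^ 2 := by ring
    _ ≤ 2 * (h * b) ^ 2 + 2 * (C₀ * √c * K) ^ 2 * (2 * (a ^ 2 + (h * b) ^ 2)) := by
        gcongr
        exact add_sq_le
    _ ≤ _ := by nlinarith [sq_nonneg a]

/-! ### The jump estimate -/

lemma isWeakCurl_triCurl {t : Finset Plane} {v : Plane → Fin 2 → ℝ} (h : CurlRegular t v) :
    IsWeakCurl (interior (hull t)) v (triCurl t v) := by
  rw [triCurl, weakCurl, dif_pos h.1]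
  exact h.1.choose_spec

lemma isTangentialTrace_tangentialTrace {t : Finset Plane} {v : Plane → Fin 2 → ℝ}
    (h : CurlRegular t v) : IsTangentialTrace t v (tangentialTrace t v) := by
  rw [tangentialTrace, dif_pos h.2]
  exact h.2.choose_spec

lemma memLp_triCurl {t : Finset Plane} {v : Plane → Fin 2 → ℝ} (h : CurlRegular t v) :
    MemLp (triCurl t v) 2 (volume.restrict (hull t)) := by
  have := (isWeakCurl_triCurl h).1
  rwa [InL2, restrict_interior_hull] at this

lemma memLp_tangentialJump {𝒯 : Finset (Finset Plane)} {v : Plane → Fin 2 → ℝ}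
    (h : ∀ t ∈ 𝒯, CurlRegular t v) {e : Finset Plane} (he : e.card = 2) :
    MemLp (tangentialJump 𝒯 v e) 2 (edgeMeasure e) := by
  unfold tangentialJump
  refine memLp_finsetSum _ fun t ht => ?_
  rw [Finset.mem_filter] at ht
  exact (isTangentialTrace_tangentialTrace (h t ht.1)).1 e
    (Finset.mem_powersetCard.mpr ⟨ht.2, he⟩)

/-- The restriction of a polynomial to a line. -/
lemma exists_eval_eq_peval {N : ℕ} {P : MvPolynomial (Fin 2) ℝ} (hP : P.totalDegree ≤ N)
    (m d : Plane) : ∃ q : Polynomial ℝ, q.natDegree ≤ N ∧ ∀ s : ℝ, q.eval s = peval P (m + s • d) := by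
  refine ⟨MvPolynomial.aeval (fun i => Polynomial.C (m i) + Polynomial.C (d i) * Polynomial.X) P,
    ?_, fun s => ?_⟩
  · have := MvPolynomial.aeval_natDegree_le (n := 1) P hP
      (fun i => Polynomial.C (m i) + Polynomial.C (d i) * Polynomial.X) fun i => by
        rw [add_comm]
        exact Polynomial.natDegree_linear_le
    simpa using this
  · rw [peval, ← Polynomial.coe_aeval_eq_eval, ← AlgHom.comp_apply, MvPolynomial.comp_aeval,
      ← MvPolynomial.aeval_eq_eval]
    simp [mul_comm s]

lemma bump_smul_of_norm_eq_one {r : ℝ} {τ : Plane} (hτ : ‖τ‖ = 1) (s : ℝ) :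
    bump r (s • τ) = bump r s := by
  simp [bump, norm_smul, hτ]

/-- A polynomial on an edge with direction `τ` is extended to the plane as constant in the normal
direction, and the extension inherits the derivative bound. -/
lemma norm_fderiv_eval_inner_le {τ : Plane} (hτ : ‖τ‖ = 1) (q : Polynomial ℝ) {M : ℝ}
    (hM : ∀ s : ℝ, ‖s‖ ≤ 1 → ‖fderiv ℝ (fun y => q.eval y) s‖ ≤ M) (y : Plane) (hy : ‖y‖ ≤ 1) :
    ‖fderiv ℝ (fun y => q.eval (inner ℝ τ y)) y‖ ≤ M := by
  have hn : ‖(inner ℝ τ y : ℝ)‖ ≤ 1 := (norm_inner_le_norm τ y).trans (by rwa [hτ, one_mul])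
  have h1 : HasFDerivAt (fun y : Plane => (inner ℝ τ y : ℝ)) (innerSL ℝ τ) y :=
    (innerSL ℝ τ).hasFDerivAt
  have h2 : HasFDerivAt (fun y => q.eval (inner ℝ τ y))
      ((fderiv ℝ (fun y => q.eval y) (inner ℝ τ y)).comp (innerSL ℝ τ)) y :=
    HasFDerivAt.comp (g := fun y => q.eval y) y q.differentiableAt.hasFDerivAt h1
  rw [h2.fderiv]
  refine (ContinuousLinearMap.opNorm_comp_le _ _).trans ?_
  rw [innerSL_apply_norm, hτ, mul_one]
  exact hM _ hn

lemma contDiff_eval_inner (τ : Plane) (q : Polynomial ℝ) :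
    ContDiff ℝ ∞ fun y : Plane => q.eval (inner ℝ τ y) := by
  have h := q.contDiff_aeval (𝕜 := ℝ) ∞
  simp only [Polynomial.coe_aeval_eq_eval] at h
  exact h.comp (innerSL ℝ τ).contDiff

/-- A smooth function supported close to the midpoint of an edge of a triangle sees only this
edge. -/
lemma integral_trace_eq {c : ℝ} {t : Finset Plane} (ht : IsRegularTriangle c t) {a b : Plane}
    (ha : a ∈ t) (hb : b ∈ t) (hab : a ≠ b) {v : Plane → Fin 2 → ℝ} {g φ : Plane → ℝ}
    (hg : IsTangentialTrace t v g) (hφ : ContDiff ℝ ∞ φ)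
    (hsupp : tsupport φ ⊆ Metric.closedBall (midpoint ℝ a b) (relRadius c * dist a b)) :
    ∫ x, g x * φ x ∂edgeMeasure {a, b} =
      (∫ x in hull t, triCurl t v x * φ x) + ∫ x in hull t, v x ⬝ᵥ vecCurl φ x := by
  rw [hg.2 φ hφ]
  obtain ⟨lam, hl⟩ := exists_isBarycentric ht.card_eq ht.nondegenerate
  have he : {a, b} ∈ edges t := by
    rw [edges, Finset.mem_powersetCard]
    refine ⟨fun v hv => ?_, Finset.card_pair hab⟩
    simp only [Finset.mem_insert, Finset.mem_singleton] at hv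
    rcases hv with rfl | rfl <;> assumption
  refine (Finset.sum_eq_single_of_mem (f := fun e => ∫ x, g x * φ x ∂edgeMeasure e) _ he
    fun e he' hne => ?_).symm
  refine integral_eq_zero_of_ae ((ae_edgeMeasure_mem e).mono fun x hx => ?_)
  rw [edges, Finset.mem_powersetCard] at he'
  -- Any other edge of `t` omits `a` or `b`, so the coordinate of that vertex vanishes on it,
  -- whereas both coordinates are positive on the support of `φ`.
  have hφ0 : φ x = 0 := by
    by_contra h0
    have hx' : dist x (midpoint ℝ a b) ≤ relRadius c * dist a b :=
      hsupp (subset_tsupport φ h0)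
    have hpa := ht.coord_pos hl ha hb hab hx'
    have hpb := ht.coord_pos hl hb ha hab.symm (by rwa [midpoint_comm, dist_comm b a])
    apply hne
    refine (Finset.eq_of_subset_of_card_le (fun w hw => ?_)
      (by rw [he'.2, Finset.card_pair hab])).symm
    by_contra hwe
    simp only [Finset.mem_insert, Finset.mem_singleton] at hw
    have hsub : (e : Set Plane) ⊆ t := by exact_mod_cast he'.1
    rcases hw with rfl | rfl
    · exact hpa.ne' (hl.eq_zero_of_mem ha hsub hwe hx)
    · exact hpb.ne' (hl.eq_zero_of_mem hb hsub hwe hx)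
  simp [hφ0]

lemma exists_pair_of_mem_edges {t e : Finset Plane} (he : e ∈ edges t) :
    ∃ a b, a ≠ b ∧ a ∈ t ∧ b ∈ t ∧ e = {a, b} := by
  rw [edges, Finset.mem_powersetCard] at he
  obtain ⟨a, b, hab, rfl⟩ := Finset.card_eq_two.mp he.2
  exact ⟨a, b, hab, he.1 (by simp), he.1 (by simp), rfl⟩

lemma InL2Vec.restrict_hull {Ω : Set Plane} {𝒯 : Finset (Finset Plane)}
    (h : IsTriangulation Ω 𝒯) {t : Finset Plane} (ht : t ∈ 𝒯) {v : Plane → Fin 2 → ℝ}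
    (hv : InL2Vec Ω v) : InL2Vec (hull t) v :=
  fun i => (hv i).mono_measure (h.restrict_hull_le ht)

/-- The orthogonality relation that underlies the jump estimate: testing the error with the curl
of a function that is supported close to the midpoint of an edge. -/
lemma integral_jump_eq {c : ℝ} {Ω : Set Plane} {𝒯 : Finset (Finset Plane)}
    (h : IsTriangulation Ω 𝒯) (hs : ShapeRegular c 𝒯) {u : Plane → ℝ} {G : Plane → Fin 2 → ℝ}
    (hG : IsH10 Ω u G) {v : Plane → Fin 2 → ℝ} (hv : InL2Vec Ω v)
    (hcr : ∀ t ∈ 𝒯, CurlRegular t v) {a b : Plane} (hab : a ≠ b) {φ : Plane → ℝ}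
    (hφ : ContDiff ℝ ∞ φ) (hφc : HasCompactSupport φ)
    (hsupp : tsupport φ ⊆ Metric.closedBall (midpoint ℝ a b) (relRadius c * dist a b)) :
    ∫ x, tangentialJump 𝒯 v {a, b} x * φ x ∂edgeMeasure {a, b} =
      ∑ t ∈ 𝒯 with {a, b} ⊆ t, ((∫ x in hull t, triCurl t v x * φ x) -
        ∫ x in hull t, (G x - v x) ⬝ᵥ vecCurl φ x) := by
  have hφe : MemLp φ 2 (edgeMeasure {a, b}) := by
    obtain ⟨B, hB⟩ := hφ.continuous.bounded_above_of_compact_support hφc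
    exact MemLp.of_bound hφ.continuous.aestronglyMeasurable B (Eventually.of_forall hB)
  have hdot : ∀ {w : Plane → Fin 2 → ℝ} {S : Set Plane}, InL2Vec S w →
      IntegrableOn (fun x => w x ⬝ᵥ vecCurl φ x) S := by
    intro w S hw
    have hφC : ∀ i, MemLp (fun x => vecCurl φ x i) 2 (volume.restrict S) := fun i =>
      memLp_of_contDiff (contDiff_vecCurl hφ i) (hasCompactSupport_vecCurl hφc i) _
    simp only [dotProduct, Fin.sum_univ_two]
    exact ((hw 0).integrable_mul (hφC 0)).add ((hw 1).integrable_mul (hφC 1))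
  -- Only the sum over the patch is claimed to vanish: the common edge is interior to the patch but
  -- lies in the boundary of each of its triangles.
  have hzero : ∑ t ∈ 𝒯 with {a, b} ⊆ t, ∫ x in hull t, G x ⬝ᵥ vecCurl φ x = 0 := by
    rw [← h.setIntegral_biUnion_hull (Finset.filter_subset _ _) (hdot hG.2.1)]
    exact hG.setIntegral_dotProduct_vecCurl hφ hφc
      (Finset.measurableSet_biUnion _ fun t _ => measurableSet_hull t)
      (h.restrict_biUnion_hull_le (Finset.filter_subset _ _))
      fun x hx hxΩ => h.mem_nhds_or_compl_mem_nhds hs hab (hsupp hx) hxΩ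
  have hstep : ∀ t ∈ 𝒯.filter ({a, b} ⊆ ·),
      (∫ x in hull t, triCurl t v x * φ x) - ∫ x in hull t, (G x - v x) ⬝ᵥ vecCurl φ x =
        (∫ x, tangentialTrace t v x * φ x ∂edgeMeasure {a, b}) -
          ∫ x in hull t, G x ⬝ᵥ vecCurl φ x := by
    intro t ht
    rw [Finset.mem_filter] at ht
    rw [integral_trace_eq (h.isRegularTriangle hs ht.1) (ht.2 (by simp)) (ht.2 (by simp)) hab
      (isTangentialTrace_tangentialTrace (hcr t ht.1)) hφ hsupp]
    simp only [sub_dotProduct]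
    rw [integral_sub (hdot (hG.2.1.restrict_hull h ht.1)) (hdot (hv.restrict_hull h ht.1))]
    ring
  rw [Finset.sum_congr rfl hstep, Finset.sum_sub_distrib, hzero, sub_zero,
    ← integral_finsetSum]
  · simp only [tangentialJump, Finset.sum_mul]
  · intro t ht
    rw [Finset.mem_filter] at ht
    exact ((isTangentialTrace_tangentialTrace (hcr t ht.1)).1 _
      (Finset.mem_powersetCard.mpr ⟨ht.2, Finset.card_pair hab⟩)).integrable_mul hφe

lemma sq_sum_mul_add_le {ι : Type*} {N : Finset ι} {κ : ℝ} (hκ : (N.card : ℝ) ≤ κ)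
    (x y z : ι → ℝ) : (∑ s ∈ N, (x s * y s + z s)) ^ 2 ≤
      2 * κ * ∑ s ∈ N, (x s ^ 2 * y s ^ 2 + z s ^ 2) := by
  have h0 : 0 ≤ ∑ s ∈ N, (x s * y s + z s) ^ 2 := Finset.sum_nonneg fun _ _ => sq_nonneg _
  have hκ0 : 0 ≤ κ := (Nat.cast_nonneg _).trans hκ
  calc _ ≤ N.card * ∑ s ∈ N, (x s * y s + z s) ^ 2 := sq_sum_le_card_mul_sum_sq
    _ ≤ κ * ∑ s ∈ N, (x s * y s + z s) ^ 2 := by gcongr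
    _ ≤ κ * ∑ s ∈ N, 2 * (x s ^ 2 * y s ^ 2 + z s ^ 2) := by
        gcongr with s hs
        rw [← mul_pow]
        exact add_sq_le
    _ = _ := by
        rw [← Finset.mul_sum]
        ring

/-- Every polynomial on an edge has a smooth extension, weighted by a bump and supported close to
the midpoint of the edge, with the natural bounds. -/
lemma exists_edge_bump (N : ℕ) {c : ℝ} (hc : 0 < c) : ∃ C : ℝ, 0 < C ∧ ∀ a b : Plane, a ≠ b →
    ∀ P : MvPolynomial (Fin 2) ℝ, P.totalDegree ≤ N → ∃ (φ : Plane → ℝ) (M : ℝ),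
      0 ≤ M ∧ ContDiff ℝ ∞ φ ∧ HasCompactSupport φ ∧
      tsupport φ ⊆ Metric.closedBall (midpoint ℝ a b) (relRadius c * dist a b) ∧
      (∀ x, |φ x| ≤ M) ∧ (∀ x i, |vecCurl φ x i| ≤ C * M / dist a b) ∧
      (∀ x ∈ hull {a, b}, |peval P x| ≤ M) ∧
      dist a b * M ^ 2 ≤ C * ∫ x, peval P x * φ x ∂edgeMeasure {a, b} := by
  have hr : 0 < relRadius c := relRadius_pos hc
  have hr1 : relRadius c ≤ 1 := (relRadius_le hc).trans (by norm_num)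
  obtain ⟨C₀, hC₀, hbound⟩ := exists_eval_bound N hr
  obtain ⟨B, hB0, hB⟩ := exists_fderiv_bump_bound (X := Plane) hr.le
  -- `1 + B` serves the bound on `Curl φ`, and `C₀ ^ 2` the final lower bound, where `M = C₀ * √Q`.
  refine ⟨1 + B + C₀ ^ 2, by positivity, fun a b hab P hP => ?_⟩
  have hℓ : 0 < dist a b := dist_pos.mpr hab
  -- `q` is `P` along the edge in the variable `s ∈ [-1/2, 1/2]`, measured from the midpoint in
  -- units of the edge length.
  obtain ⟨q, hq, hqP⟩ := exists_eval_eq_peval hP (midpoint ℝ a b) (b - a)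
  obtain ⟨τ, hτdef⟩ : ∃ τ : Plane, τ = (dist a b)⁻¹ • (b - a) := ⟨_, rfl⟩
  have hτ : ‖τ‖ = 1 := by
    rw [hτdef, norm_smul, norm_inv, Real.norm_of_nonneg hℓ.le, ← dist_eq_norm, dist_comm b a,
      inv_mul_cancel₀ hℓ.ne']
  obtain ⟨Q, hQdef⟩ : ∃ Q, Q = ∫ y : ℝ, bump (relRadius c) y * q.eval y ^ 2 := ⟨_, rfl⟩
  have hQ0 : 0 ≤ Q := hQdef ▸ integral_nonneg fun y => mul_nonneg (bump_nonneg _ _) (sq_nonneg _)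
  have hb := hbound q hq
  rw [← hQdef] at hb
  have hb0 : ∀ y : Plane, ‖y‖ ≤ 1 → |q.eval (inner ℝ τ y)| ≤ C₀ * √Q := fun y hy =>
    (hb _ ((norm_inner_le_norm τ y).trans (by rwa [hτ, one_mul]))).1
  have hb1 := norm_fderiv_eval_inner_le hτ q fun s hs => (hb s hs).2
  have hgc := contDiff_eval_inner τ q
  have hφs : ∀ s : ℝ, localized (relRadius c) (dist a b) (midpoint ℝ a b)
      (fun y => q.eval (inner ℝ τ y)) (midpoint ℝ a b + s • (b - a)) =
        bump (relRadius c) s * q.eval s := by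
    intro s
    have : (dist a b)⁻¹ • (midpoint ℝ a b + s • (b - a) - midpoint ℝ a b) = s • τ := by
      rw [add_sub_cancel_left, smul_comm, hτdef]
    simp only [localized, this, bump_smul_of_norm_eq_one hτ, inner_smul_right,
      real_inner_self_eq_norm_sq, hτ]
    norm_num
  refine ⟨localized (relRadius c) (dist a b) (midpoint ℝ a b) (fun y => q.eval (inner ℝ τ y)),
    C₀ * √Q, by positivity, contDiff_localized hgc, hasCompactSupport_localized hr.le hℓ,
    tsupport_localized_subset hr.le hℓ, abs_localized_le hr.le hr1 hb0, fun x i => ?_,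
    fun x hx => ?_, ?_⟩
  · refine (abs_vecCurl_le _ x i).trans
      ((norm_fderiv_localized_le hr.le hr1 hℓ hB hgc hb0 hb1 x).trans ?_)
    exact div_le_div_of_nonneg_right (mul_le_mul_of_nonneg_right
      (le_add_of_nonneg_right (sq_nonneg C₀)) (by positivity)) hℓ.le
  · obtain ⟨s, hs1, rfl⟩ := exists_eq_of_mem_hull_pair hx
    rw [← hqP]
    exact (hb s (hs1.trans (by norm_num))).1
  · have e1 : ∫ x, peval P x * localized (relRadius c) (dist a b) (midpoint ℝ a b)
        (fun y => q.eval (inner ℝ τ y)) x ∂edgeMeasure {a, b} = dist a b * Q := by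
      rw [integral_edgeMeasure hab, hQdef]
      · congr 2 with s
        rw [hφs, ← hqP]
        ring
      · intro s hs1
        rw [hφs, bump_eq_zero hr.le]
        · ring
        · have := relRadius_le hc
          rw [Real.norm_eq_abs]
          linarith
    rw [e1, mul_pow, Real.sq_sqrt hQ0]
    have : 0 ≤ (1 + B) * (dist a b * Q) := by positivity
    linarith

/-- The contribution of one triangle to the jump estimate. -/
lemma abs_residual_le {c : ℝ} {t : Finset Plane} (ht : IsRegularTriangle c t)
    {G v : Plane → Fin 2 → ℝ} (hG : InL2Vec (hull t) G) (hv : InL2Vec (hull t) v)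
    (hcr : CurlRegular t v) {φ : Plane → ℝ} (hφ : ContDiff ℝ ∞ φ) (hφc : HasCompactSupport φ)
    {M L ℓ : ℝ} (hM : 0 ≤ M) (hL : 0 ≤ L) (hℓ : 0 < ℓ) (hφM : ∀ x, |φ x| ≤ M)
    (hφM' : ∀ x i, |vecCurl φ x i| ≤ L * M / ℓ) (hle : size t ≤ c * ℓ) :
    |(∫ x in hull t, triCurl t v x * φ x) - ∫ x in hull t, (G x - v x) ⬝ᵥ vecCurl φ x| ≤
      M * ((√c * (1 + 2 * L * c)) * (size t * √(∫ x in hull t, triCurl t v x ^ 2) +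
        √(∫ x in hull t, (G x - v x) ⬝ᵥ (G x - v x)))) := by
  have hfin : IsFiniteMeasure (volume.restrict (hull t)) :=
    ⟨by rw [Measure.restrict_apply_univ]; exact volume_hull_lt_top t⟩
  have hV : √((volume.restrict (hull t)).real Set.univ) ≤ √c * size t := by
    rw [measureReal_restrict_apply_univ]
    exact sqrt_volume_hull_le ht
  have hc := ht.const_pos
  have hs := ht.size_pos
  have k1 := abs_integral_mul_le_of_bound hM (memLp_triCurl hcr)
    (memLp_of_contDiff hφ hφc (hull t)) (Eventually.of_forall hφM)
  have k2 := abs_integral_dotProduct_le_of_bound (e := fun x => G x - v x) (g := vecCurl φ)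
    (by positivity : 0 ≤ L * M / ℓ) (fun i => (hG i).sub (hv i))
    (fun i => memLp_of_contDiff (contDiff_vecCurl hφ i) (hasCompactSupport_vecCurl hφc i) _)
    (fun i => Eventually.of_forall fun x => hφM' x i)
  have hγ := Real.sqrt_nonneg (∫ x in hull t, triCurl t v x ^ 2)
  have hα := Real.sqrt_nonneg (∫ x in hull t, (G x - v x) ⬝ᵥ (G x - v x))
  generalize √(∫ x in hull t, triCurl t v x ^ 2) = γ at *
  generalize √(∫ x in hull t, (G x - v x) ⬝ᵥ (G x - v x)) = α at *
  calc _ ≤ M * (√c * size t) * γ + 2 * (L * M / ℓ) * (√c * (c * ℓ)) * α := by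
        refine (abs_sub _ _).trans (add_le_add (k1.trans ?_) (k2.trans ?_))
        · gcongr
        · have := hV.trans (mul_le_mul_of_nonneg_left hle (Real.sqrt_nonneg c))
          gcongr
    _ = M * (√c * (size t * γ) + √c * (2 * L * c) * α) := by
        field_simp
    _ ≤ _ := by
        refine mul_le_mul_of_nonneg_left ?_ hM
        have k1 : 0 ≤ √c * (2 * L * c) * (size t * γ) := by positivity
        have k2 : 0 ≤ √c * α := by positivity
        linarith

/-- The arithmetic of the jump estimate. Here `I` and `R` are the squared norms of the jump and of
the polynomial, `β` is the norm of their difference, `M` a sup bound for the polynomial, and `X` the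
sum of the residuals on the patch. Squaring `h1` bounds `(ℓ * M) ^ 2`, and `h * R ≤ c * (ℓ * M) ^
2`. -/
lemma mul_le_of_trace_bounds {c ℓ h K κ M β X Y I R : ℝ} (hc : 0 < c) (hℓ : 0 < ℓ) (hM : 0 ≤ M)
    (hℓh : ℓ ≤ h) (hh : h ≤ c * ℓ) (h1 : ℓ * M ≤ K * (√ℓ * β + X)) (h2 : X ^ 2 ≤ κ * Y)
    (h3 : I ≤ 2 * β ^ 2 + 2 * R) (h4 : R ≤ (M * √ℓ) ^ 2) (hκ : 0 ≤ κ) (hY : 0 ≤ Y) :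
    h * I ≤ (2 + 4 * c * K ^ 2 * (1 + κ)) * (h * β ^ 2 + Y) := by
  have hh0 : 0 < h := hℓ.trans_le hℓh
  have j5 : (ℓ * M) ^ 2 ≤ 2 * K ^ 2 * (h * β ^ 2 + κ * Y) := by
    calc (ℓ * M) ^ 2 ≤ (K * (√ℓ * β + X)) ^ 2 := by gcongr
      _ = K ^ 2 * (√ℓ * β + X) ^ 2 := by ring
      _ ≤ K ^ 2 * (2 * ((√ℓ * β) ^ 2 + X ^ 2)) := by
          gcongr
          exact add_sq_le
      _ = 2 * K ^ 2 * (ℓ * β ^ 2 + X ^ 2) := by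
          rw [mul_pow, Real.sq_sqrt hℓ.le]
          ring
      _ ≤ _ := by gcongr
  have h0 : 0 ≤ 4 * c * K ^ 2 := by positivity
  have h0' : 0 ≤ 4 * c * K ^ 2 * κ := by positivity
  calc h * I ≤ h * (2 * β ^ 2 + 2 * (M * √ℓ) ^ 2) := by
        gcongr
        linarith
    _ = 2 * (h * β ^ 2) + 2 * (M ^ 2 * ℓ) * h := by
        rw [mul_pow, Real.sq_sqrt hℓ.le]
        ring
    _ ≤ 2 * (h * β ^ 2) + 2 * (M ^ 2 * ℓ) * (c * ℓ) := by gcongr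
    _ = 2 * (h * β ^ 2) + 2 * c * (ℓ * M) ^ 2 := by ring
    _ ≤ 2 * (h * β ^ 2) + 2 * c * (2 * K ^ 2 * (h * β ^ 2 + κ * Y)) := by gcongr
    _ = (2 + 4 * c * K ^ 2) * (h * β ^ 2) + (4 * c * K ^ 2 * κ) * Y := by ring
    _ ≤ (2 + 4 * c * K ^ 2 * (1 + κ)) * (h * β ^ 2) + (2 + 4 * c * K ^ 2 * (1 + κ)) * Y := by
        have k1 : 0 ≤ 4 * c * K ^ 2 * κ * (h * β ^ 2) := by positivity
        have k2 : 0 ≤ 4 * c * K ^ 2 * Y := by positivity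
        linarith
    _ = _ := by ring

/-- The tangential jump on an edge is bounded by the error, the volume residuals and the
oscillation on the adjacent triangles. -/
lemma exists_jump_bound (N : ℕ) (c : ℝ) : ∃ C : ℝ, 0 < C ∧
    ∀ (Ω : Set Plane) (𝒯 : Finset (Finset Plane)), IsTriangulation Ω 𝒯 → ShapeRegular c 𝒯 →
    ∀ (u : Plane → ℝ) (G v : Plane → Fin 2 → ℝ), IsH10 Ω u G → InL2Vec Ω v →
    (∀ t ∈ 𝒯, CurlRegular t v) → ∀ t ∈ 𝒯, ∀ e ∈ edges t,
    ∀ P : MvPolynomial (Fin 2) ℝ, P.totalDegree ≤ N →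
      size t * ∫ x, tangentialJump 𝒯 v e x ^ 2 ∂edgeMeasure e ≤
        C * (size t * (∫ x, (tangentialJump 𝒯 v e x - peval P x) ^ 2 ∂edgeMeasure e) +
          ∑ s ∈ 𝒯 with e ⊆ s, (size s ^ 2 * (∫ x in hull s, triCurl s v x ^ 2) +
            ∫ x in hull s, (G x - v x) ⬝ᵥ (G x - v x))) := by
  by_cases hc : 0 < c
  swap
  · exact ⟨1, one_pos, fun Ω 𝒯 h hs _ _ _ _ _ _ t ht =>
      absurd (h.isRegularTriangle hs ht).const_pos hc⟩
  obtain ⟨L, hL, hbump⟩ := exists_edge_bump N hc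
  -- `L` comes from the lower bound of `exists_edge_bump`, the summand 1 from replacing the jump by
  -- `P`, and the rest from `abs_residual_le`.
  obtain ⟨K, hKdef⟩ : ∃ K, K = L * (1 + √c * (1 + 2 * L * c)) := ⟨_, rfl⟩
  have hK : 0 < K := hKdef ▸ by positivity
  -- The constant of `mul_le_of_trace_bounds`, with its `κ` equal to twice the bound on the number
  -- of triangles at the edge.
  refine ⟨2 + 4 * c * K ^ 2 * (1 + 2 * (Real.pi * c ^ 3)), by positivity, ?_⟩
  intro Ω 𝒯 h hs u G v hG hv hcr t ht e he P hP
  obtain ⟨a, b, hab, hat, hbt, rfl⟩ := exists_pair_of_mem_edges he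
  have hℓ : 0 < dist a b := dist_pos.mpr hab
  have hreg : ∀ s ∈ 𝒯, IsRegularTriangle c s := fun s hs' => h.isRegularTriangle hs hs'
  have hle : ∀ s ∈ 𝒯.filter ({a, b} ⊆ ·), size s ≤ c * dist a b := fun s hs' => by
    rw [Finset.mem_filter] at hs'
    exact (hreg s hs'.1).size_le_mul_dist (hs'.2 (by simp)) (hs'.2 (by simp)) hab
  have htN : t ∈ 𝒯.filter ({a, b} ⊆ ·) :=
    Finset.mem_filter.mpr ⟨ht, (Finset.mem_powersetCard.mp he).1⟩
  obtain ⟨φ, M, hM, hφ, hφc, hsupp, hφM, hφM', hPM, hlow⟩ := hbump a b hab P hP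
  have hφe : MemLp φ 2 (edgeMeasure {a, b}) :=
    MemLp.of_bound hφ.continuous.aestronglyMeasurable M (Eventually.of_forall hφM)
  have hJ : MemLp (tangentialJump 𝒯 v {a, b}) 2 (edgeMeasure {a, b}) :=
    memLp_tangentialJump hcr (Finset.card_pair hab)
  have hPM' : ∀ᵐ x ∂edgeMeasure {a, b}, |peval P x| ≤ M := (ae_edgeMeasure_mem _).mono hPM
  have hP2 : MemLp (peval P) 2 (edgeMeasure {a, b}) :=
    MemLp.of_bound (contDiff_peval P).continuous.aestronglyMeasurable M hPM'
  have hE : √((edgeMeasure {a, b}).real Set.univ) = √(dist a b) := by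
    rw [Measure.real, edgeMeasure_univ, edist_dist, ENNReal.toReal_ofReal dist_nonneg]
  have e2 := integral_sub_mul hJ hP2 hφe
  have e3 := integral_jump_eq h hs hG hv hcr hab hφ hφc hsupp
  have i1 := abs_integral_mul_le_of_bound (f := fun x => tangentialJump 𝒯 v {a, b} x - peval P x)
    hM (hJ.sub hP2) hφe (Eventually.of_forall hφM)
  have i2 : ∀ s ∈ 𝒯.filter ({a, b} ⊆ ·), _ := fun s hs' =>
    have hsT := (Finset.mem_filter.mp hs').1
    abs_residual_le (hreg s hsT) (hG.2.1.restrict_hull h hsT) (hv.restrict_hull h hsT)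
      (hcr s hsT) hφ hφc hM hL.le hℓ hφM hφM' (hle s hs')
  have i3 := (Finset.abs_sum_le_sum_abs _ _).trans (Finset.sum_le_sum i2)
  rw [← e3, ← Finset.mul_sum, ← Finset.mul_sum] at i3
  have j4 := integral_sq_le_two_mul hJ hP2
  have hcard := (h.card_filter_le hs hab (Finset.filter_subset ({a, b} ⊆ ·) 𝒯)
    (fun s hs' => (Finset.mem_filter.mp hs').2 (Finset.mem_insert_self a {b}))
    (fun s hs' => (Finset.mem_filter.mp hs').2 (Finset.mem_insert_of_mem
      (Finset.mem_singleton_self b)))).resolve_right (Finset.ne_empty_of_mem htN)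
  have hXY := sq_sum_mul_add_le hcard size (fun s => √(∫ x in hull s, triCurl s v x ^ 2))
    (fun s => √(∫ x in hull s, (G x - v x) ⬝ᵥ (G x - v x)))
  have hY : ∀ s, size s ^ 2 * √(∫ x in hull s, triCurl s v x ^ 2) ^ 2 +
      √(∫ x in hull s, (G x - v x) ⬝ᵥ (G x - v x)) ^ 2 =
        size s ^ 2 * (∫ x in hull s, triCurl s v x ^ 2) +
          ∫ x in hull s, (G x - v x) ⬝ᵥ (G x - v x) := fun s => by
    rw [Real.sq_sqrt (integral_nonneg fun x => sq_nonneg _),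
      Real.sq_sqrt (integral_nonneg fun x => dotProduct_self_nonneg _)]
  simp only [hY] at hXY
  have hX0 : 0 ≤ ∑ s ∈ 𝒯 with {a, b} ⊆ s, (size s * √(∫ x in hull s, triCurl s v x ^ 2) +
      √(∫ x in hull s, (G x - v x) ⬝ᵥ (G x - v x))) := Finset.sum_nonneg fun s hs' => by
    have := (hreg s (Finset.mem_filter.mp hs').1).size_pos
    positivity
  have hY0 : 0 ≤ ∑ s ∈ 𝒯 with {a, b} ⊆ s, (size s ^ 2 * (∫ x in hull s, triCurl s v x ^ 2) +
      ∫ x in hull s, (G x - v x) ⬝ᵥ (G x - v x)) := Finset.sum_nonneg fun s _ => by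
    rw [← hY]
    positivity
  have hβ2 : √(∫ x, (tangentialJump 𝒯 v {a, b} x - peval P x) ^ 2 ∂edgeMeasure {a, b}) ^ 2 =
      ∫ x, (tangentialJump 𝒯 v {a, b} x - peval P x) ^ 2 ∂edgeMeasure {a, b} :=
    Real.sq_sqrt (integral_nonneg fun x => sq_nonneg _)
  have j3 : ∫ x, peval P x ^ 2 ∂edgeMeasure {a, b} ≤ (M * √(dist a b)) ^ 2 := by
    rw [← Real.sqrt_le_left (by positivity), ← hE]
    exact sqrt_integral_sq_le hM hPM'
  rw [hE] at i1
  rw [← hβ2] at j4 ⊢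
  have hβ0 := Real.sqrt_nonneg
    (∫ x, (tangentialJump 𝒯 v {a, b} x - peval P x) ^ 2 ∂edgeMeasure {a, b})
  refine mul_le_of_trace_bounds hc hℓ hM (dist_le_size (mem_hull hat) (mem_hull hbt)) (hle t htN)
    ?_ hXY j4 j3 (by positivity) hY0
  generalize √(∫ x, (tangentialJump 𝒯 v {a, b} x - peval P x) ^ 2 ∂edgeMeasure {a, b}) = β at *
  generalize (∑ s ∈ 𝒯 with {a, b} ⊆ s, (size s * √(∫ x in hull s, triCurl s v x ^ 2) +
      √(∫ x in hull s, (G x - v x) ⬝ᵥ (G x - v x)))) = X at *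
  generalize ∫ x, tangentialJump 𝒯 v {a, b} x * φ x ∂edgeMeasure {a, b} = I₁ at *
  generalize ∫ x, (tangentialJump 𝒯 v {a, b} x - peval P x) * φ x ∂edgeMeasure {a, b} = I₂ at *
  generalize ∫ x, peval P x * φ x ∂edgeMeasure {a, b} = I₃ at *
  -- All bounds are linear in the size `M` of the test function; one factor `M` is cancelled.
  rcases hM.eq_or_lt with h0 | h0
  · rw [← h0, mul_zero]
    positivity
  · refine le_of_mul_le_mul_left ?_ h0
    have k1 := (abs_le.mp i1).1
    have k2 := (abs_le.mp i3).2
    calc M * (dist a b * M) = dist a b * M ^ 2 := by ring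
      _ ≤ L * I₃ := hlow
      _ ≤ L * (M * (√c * (1 + 2 * L * c) * X) + M * √(dist a b) * β) := by
          gcongr
          linarith
      _ ≤ _ := by
          have l1 : 0 ≤ L * M * X := by positivity
          have l2 : 0 ≤ L * (√c * (1 + 2 * L * c)) * (M * (√(dist a b) * β)) := by positivity
          rw [hKdef]
          linarith

/-! ### The energy norm -/

lemma isUnit_det_of_coercive {lam : ℝ} (hlam : 0 < lam) {A : Matrix (Fin 2) (Fin 2) ℝ}
    (hA : ∀ ξ : Fin 2 → ℝ, lam * (ξ ⬝ᵥ ξ) ≤ ξ ⬝ᵥ (A *ᵥ ξ)) : IsUnit A.det := by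
  rw [← Matrix.isUnit_iff_isUnit_det, ← Matrix.mulVec_injective_iff_isUnit]
  refine (injective_iff_map_eq_zero (Matrix.mulVecLin A)).mpr fun ξ hξ => ?_
  have h := hA ξ
  rw [Matrix.mulVecLin_apply] at hξ
  rw [hξ, dotProduct_zero] at h
  have h0 : ξ ⬝ᵥ ξ ≤ 0 := by
    by_contra! hlt
    exact (mul_pos hlam hlt).not_ge h
  exact dotProduct_self_eq_zero.mp (le_antisymm h0 (dotProduct_self_nonneg ξ))

/-- With `w = A⁻¹ q`, coercivity gives `lam * |w|² ≤ w · q ≤ |w| (|q 0| + |q 1|)`; division by `|w|`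
finishes. -/
lemma abs_inv_mulVec_le {lam : ℝ} (hlam : 0 < lam) {A : Matrix (Fin 2) (Fin 2) ℝ}
    (hA : ∀ ξ : Fin 2 → ℝ, lam * (ξ ⬝ᵥ ξ) ≤ ξ ⬝ᵥ (A *ᵥ ξ)) (q : Fin 2 → ℝ) (i : Fin 2) :
    |(A⁻¹ *ᵥ q) i| ≤ lam⁻¹ * (|q 0| + |q 1|) := by
  obtain ⟨w, hw⟩ : ∃ w, w = A⁻¹ *ᵥ q := ⟨_, rfl⟩
  have hAw : A *ᵥ w = q := by
    rw [hw, Matrix.mulVec_mulVec, Matrix.mul_nonsing_inv _ (isUnit_det_of_coercive hlam hA),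
      Matrix.one_mulVec]
  have h := hA w
  rw [hAw] at h
  rw [← hw]
  simp only [dotProduct, Fin.sum_univ_two] at h
  have hr := Real.sqrt_nonneg (w 0 * w 0 + w 1 * w 1)
  have hr2 : √(w 0 * w 0 + w 1 * w 1) ^ 2 = w 0 * w 0 + w 1 * w 1 :=
    Real.sq_sqrt (by nlinarith [mul_self_nonneg (w 0), mul_self_nonneg (w 1)])
  have hwr : ∀ j, |w j| ≤ √(w 0 * w 0 + w 1 * w 1) := fun j => by
    apply Real.abs_le_sqrt
    fin_cases j
    · change w 0 ^ 2 ≤ _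
      nlinarith [mul_self_nonneg (w 1)]
    · change w 1 ^ 2 ≤ _
      nlinarith [mul_self_nonneg (w 0)]
  rw [← hr2] at h
  generalize √(w 0 * w 0 + w 1 * w 1) = r at *
  refine (hwr i).trans ?_
  rw [inv_mul_eq_div, le_div_iff₀ hlam]
  rcases hr.eq_or_lt with h0 | h0
  · rw [← h0, zero_mul]
    positivity
  · refine le_of_mul_le_mul_left ?_ h0
    have h1 : ∀ j, w j * q j ≤ r * |q j| := fun j =>
      (le_abs_self _).trans ((abs_mul _ _).le.trans
        (mul_le_mul_of_nonneg_right (hwr j) (abs_nonneg _)))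
    have := h1 0
    have := h1 1
    nlinarith

lemma IsCoefficient.inL2Vec_invMul {lam Lam : ℝ} (hlam : 0 < lam) {Ω : Set Plane}
    {A : Plane → Matrix (Fin 2) (Fin 2) ℝ} (hA : IsCoefficient lam Lam Ω A)
    {q : Plane → Fin 2 → ℝ} (hq : InL2Vec Ω q) : InL2Vec Ω (invMul A q) := by
  intro i
  have hb : MemLp (fun x => lam⁻¹ * (|q x 0| + |q x 1|)) 2 (volume.restrict Ω) :=
    ((hq 0).abs.add (hq 1).abs).const_mul _
  refine MemLp.of_le hb ?_ ?_
  · have hm : ∀ i j, AEMeasurable (fun x => A x i j) (volume.restrict Ω) := fun i j =>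
      (hA.measurable i j).aemeasurable
    have hqm : ∀ i, AEMeasurable (fun x => q x i) (volume.restrict Ω) := fun i =>
      (hq i).aestronglyMeasurable.aemeasurable
    have hdet : AEMeasurable (fun x => (A x 0 0 * A x 1 1 - A x 0 1 * A x 1 0)⁻¹)
        (volume.restrict Ω) := (((hm 0 0).mul (hm 1 1)).sub ((hm 0 1).mul (hm 1 0))).inv
    -- The adjugate formula expresses the components in terms of the entries of `A`, which settles
    -- measurability.
    have h : ∀ x i, invMul A q x i = (A x 0 0 * A x 1 1 - A x 0 1 * A x 1 0)⁻¹ *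
        (![A x 1 1 * q x 0 - A x 0 1 * q x 1, A x 0 0 * q x 1 - A x 1 0 * q x 0] i) := by
      intro x i
      rw [invMul, Matrix.inv_def, Matrix.adjugate_fin_two, Ring.inverse_eq_inv',
        Matrix.det_fin_two]
      fin_cases i <;> simp [Matrix.mulVec, dotProduct, Fin.sum_univ_two] <;> ring
    apply AEMeasurable.aestronglyMeasurable
    simp only [h]
    refine hdet.mul ?_
    fin_cases i
    · exact ((hm 1 1).mul (hqm 0)).sub ((hm 0 1).mul (hqm 1))
    · exact ((hm 0 0).mul (hqm 1)).sub ((hm 1 0).mul (hqm 0))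
  · filter_upwards [hA.bounds] with x hx
    refine (abs_inv_mulVec_le hlam (fun ξ => (hx ξ).1) (q x) i).trans (le_abs_self _)

/-- The energy norm of the stress error controls the `L²` norm of `∇u - A⁻¹ p_h`. -/
lemma IsCoefficient.mul_integral_le {lam Lam : ℝ} (hlam : 0 < lam) {Ω : Set Plane}
    {A : Plane → Matrix (Fin 2) (Fin 2) ℝ} (hA : IsCoefficient lam Lam Ω A)
    {p ph G : Plane → Fin 2 → ℝ} (hp : InL2Vec Ω p) (hph : InL2Vec Ω ph)
    (hG : ∀ᵐ x ∂volume.restrict Ω, p x = A x *ᵥ G x) :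
    lam * ∫ x in Ω, (G x - invMul A ph x) ⬝ᵥ (G x - invMul A ph x) ≤
      ∫ x in Ω, invMul A (p - ph) x ⬝ᵥ (p - ph) x := by
  rw [← integral_const_mul]
  have hsub : InL2Vec Ω (p - ph) := fun i => (hp i).sub (hph i)
  have hinv := hA.inL2Vec_invMul hlam hsub
  refine integral_mono_of_nonneg (Eventually.of_forall fun x =>
    mul_nonneg hlam.le (dotProduct_self_nonneg _)) ?_ ?_
  · simp only [dotProduct, Fin.sum_univ_two]
    exact ((hinv 0).integrable_mul (hsub 0)).add ((hinv 1).integrable_mul (hsub 1))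
  · filter_upwards [hA.bounds, hG] with x hx hpx
    have hu := isUnit_det_of_coercive hlam fun ξ => (hx ξ).1
    -- With `e = G - A⁻¹ p_h`, the energy density is `e · A e`, and coercivity applies.
    have h1 : invMul A (p - ph) x = G x - invMul A ph x := by
      simp only [invMul, Pi.sub_apply, Matrix.mulVec_sub, hpx, Matrix.mulVec_mulVec,
        Matrix.nonsing_inv_mul _ hu, Matrix.one_mulVec]
    have h2 : (p - ph) x = A x *ᵥ (G x - invMul A ph x) := by
      rw [← h1, invMul, Matrix.mulVec_mulVec, Matrix.mul_nonsing_inv _ hu, Matrix.one_mulVec]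
    rw [h1, h2]
    exact (hx _).1

/-! ### Summation over the triangulation -/

/-- A bound for every polynomial passes to the infimum, so no minimizer has to be exhibited. -/
lemma le_mul_bestApproxErrorSq_add {m : ℕ} {μ : Measure Plane} {g : Plane → ℝ} {C a b Z : ℝ}
    (hC : 0 < C) (ha : 0 < a)
    (h : ∀ P : MvPolynomial (Fin 2) ℝ, P.totalDegree ≤ m →
      Z ≤ C * (a * (∫ x, (g x - peval P x) ^ 2 ∂μ) + b)) :
    Z ≤ C * (a * bestApproxErrorSq m μ g + b) := by
  have : Nonempty {P : MvPolynomial (Fin 2) ℝ // P.totalDegree ≤ m} := ⟨0, by simp⟩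
  have hinf : (Z / C - b) / a ≤ bestApproxErrorSq m μ g := le_ciInf fun P => by
    rw [div_le_iff₀ ha, sub_le_iff_le_add, div_le_iff₀ hC]
    exact (h P.1 P.2).trans (le_of_eq (by ring))
  rw [div_le_iff₀ ha, sub_le_iff_le_add, div_le_iff₀ hC] at hinf
  exact hinf.trans (le_of_eq (by ring))

/-- Double counting: that `e` is a common edge of `t` and `s` is symmetric in the two triangles. So
`D s` is counted once for each edge of `s` and each triangle at that edge, at most `3 * κ` times. -/
lemma sum_edges_sum_filter_le {𝒯 : Finset (Finset Plane)} {κ : ℝ} (hT : ∀ t ∈ 𝒯, t.card = 3)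
    (hκ : ∀ s ∈ 𝒯, ∀ e ∈ edges s, ((𝒯.filter (e ⊆ ·)).card : ℝ) ≤ κ) {D : Finset Plane → ℝ}
    (hD : ∀ s ∈ 𝒯, 0 ≤ D s) :
    ∑ t ∈ 𝒯, ∑ e ∈ edges t, ∑ s ∈ 𝒯 with e ⊆ s, D s ≤ 3 * κ * ∑ s ∈ 𝒯, D s := by
  calc ∑ t ∈ 𝒯, ∑ e ∈ edges t, ∑ s ∈ 𝒯 with e ⊆ s, D s
      = ∑ t ∈ 𝒯, ∑ s ∈ 𝒯, ∑ e ∈ edges t with e ⊆ s, D s := by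
        refine Finset.sum_congr rfl fun t _ => ?_
        simp only [Finset.sum_filter]
        exact Finset.sum_comm
    _ = ∑ s ∈ 𝒯, ∑ t ∈ 𝒯, ∑ e ∈ edges s with e ⊆ t, D s := by
        rw [Finset.sum_comm]
        refine Finset.sum_congr rfl fun s _ => Finset.sum_congr rfl fun t _ =>
          Finset.sum_congr ?_ fun _ _ => rfl
        ext e
        simp only [edges, Finset.mem_filter, Finset.mem_powersetCard]
        tauto
    _ = ∑ s ∈ 𝒯, ∑ e ∈ edges s, ((𝒯.filter (e ⊆ ·)).card : ℝ) * D s := by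
        refine Finset.sum_congr rfl fun s _ => ?_
        simp only [Finset.sum_filter]
        rw [Finset.sum_comm]
        refine Finset.sum_congr rfl fun e _ => ?_
        rw [← Finset.sum_filter, Finset.sum_const, nsmul_eq_mul]
    _ ≤ ∑ s ∈ 𝒯, ∑ e ∈ edges s, κ * D s := by
        gcongr with s hs e he
        · exact hD s hs
        · exact hκ s hs e he
    _ = ∑ s ∈ 𝒯, 3 * κ * D s := by
        refine Finset.sum_congr rfl fun s hs => ?_
        rw [Finset.sum_const, edges, Finset.card_powersetCard, hT s hs, nsmul_eq_mul]
        norm_num [Nat.choose]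
        ring
    _ = _ := by rw [Finset.mul_sum]

/-- The absolute value makes the bound nonnegative, which covers edges that belong to no triangle of
`𝒯`. -/
lemma IsTriangulation.card_filter_edge_le {c : ℝ} {Ω : Set Plane} {𝒯 : Finset (Finset Plane)}
    (h : IsTriangulation Ω 𝒯) (hs : ShapeRegular c 𝒯) {t e : Finset Plane} (he : e ∈ edges t) :
    ((𝒯.filter (e ⊆ ·)).card : ℝ) ≤ Real.pi * |c| ^ 3 := by
  obtain ⟨a, b, hab, -, -, rfl⟩ := exists_pair_of_mem_edges he
  rcases h.card_filter_le hs hab (Finset.filter_subset ({a, b} ⊆ ·) 𝒯)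
    (fun s hs' => (Finset.mem_filter.mp hs').2 (Finset.mem_insert_self a {b}))
    (fun s hs' => (Finset.mem_filter.mp hs').2 (Finset.mem_insert_of_mem
      (Finset.mem_singleton_self b))) with hle | h0
  · refine hle.trans ?_
    rw [← abs_pow]
    exact mul_le_mul_of_nonneg_left (le_abs_self _) Real.pi_pos.le
  · rw [h0, Finset.card_empty, Nat.cast_zero]
    positivity

end MixedFEM

end

/-! ### Assembly of the global estimate -/

open MixedFEM
theorem theorem3p5 (l n : ℕ) (hn : l + 1 ≤ n) (lam Lam c₁ : ℝ) (hlam : 0 < lam) :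
    ∃ C₂ : ℝ, 0 < C₂ ∧
      ∀ (F : Family) (Ω : Set Plane) (𝒯 : Finset (Finset Plane))
        (A : Plane → Matrix (Fin 2) (Fin 2) ℝ) (f fh : Plane → ℝ)
        (p : Plane → Fin 2 → ℝ) (u : Plane → ℝ) (ph : Plane → Fin 2 → ℝ) (uh : Plane → ℝ),
        IsTriangulation Ω 𝒯 → ShapeRegular c₁ 𝒯 → IsCoefficient lam Lam Ω A →
        InL2 Ω f → IsL2Projection l Ω 𝒯 f fh →
        IsExactSolution Ω A f p u → IsDiscreteSolution F l Ω 𝒯 A fh ph uh →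
        (∀ t ∈ 𝒯, CurlRegular t (invMul A ph)) →
        C₂ * etaSq 𝒯 A f fh ph ≤ errorSq Ω 𝒯 A p ph + oscSq n 𝒯 A f fh ph := by
  obtain ⟨K₁, hK₁, hcurl⟩ := exists_curl_bound n c₁
  obtain ⟨K₂, hK₂, hjump⟩ := exists_jump_bound (n + 1) c₁
  obtain ⟨κ, hκ⟩ : ∃ κ, κ = Real.pi * |c₁| ^ 3 := ⟨_, rfl⟩
  have hκ0 : 0 ≤ κ := hκ ▸ by positivity
  -- The summands account for the data term, the curl terms, the jump terms, and the curl and error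
  -- on neighbouring triangles that the jump bound brings in. The factor `lam⁻¹ + 1` below converts
  -- `‖G - v‖²` into the energy error.
  obtain ⟨K, hKdef⟩ : ∃ K, K = 1 + K₁ + K₂ + K₂ * (3 * κ) * (K₁ + 1) := ⟨_, rfl⟩
  have hK : 0 < K := hKdef ▸ by positivity
  refine ⟨(K * (lam⁻¹ + 1))⁻¹, by positivity, ?_⟩
  intro F Ω 𝒯 A f fh p u ph uh h hs hA hf hfh hp hph hcr
  obtain ⟨hp2, -, G, hG, hpG⟩ := hp
  have hreg := fun t ht => h.isRegularTriangle hs (t := t) ht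
  have hph2 : InL2Vec Ω ph := hph.stress_mem.1.1
  have hv := hA.inL2Vec_invMul hlam hph2
  have hener := hA.mul_integral_le hlam hp2 hph2 hpG
  generalize hvdef : invMul A ph = v at *
  have hdiff : ∀ i, MemLp (fun x => (G x - v x) i) 2 (volume.restrict Ω) := fun i =>
    (hG.2.1 i).sub (hv i)
  have hEsum := h.sum_setIntegral_le (integrable_dotProduct_self hdiff)
    fun x => dotProduct_self_nonneg _
  -- Test functions supported in the interior of `t` stay away from its frontier, so `G` is
  -- orthogonal to their curls on `t` alone.
  have hcurl' : ∀ t ∈ 𝒯, size t ^ 2 * (∫ x in hull t, triCurl t v x ^ 2) ≤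
      K₁ * (size t ^ 2 * bestApproxErrorSq n (volume.restrict (hull t)) (triCurl t v) +
        ∫ x in hull t, (G x - v x) ⬝ᵥ (G x - v x)) := fun t ht =>
    le_mul_bestApproxErrorSq_add hK₁ (by have := (hreg t ht).size_pos; positivity)
      (hcurl t (hreg t ht) v G _ (hv.restrict_hull h ht) (hG.2.1.restrict_hull h ht)
        (isWeakCurl_triCurl (hcr t ht)) fun φ hφ => hG.setIntegral_dotProduct_vecCurl hφ.smooth
          hφ.compact (measurableSet_hull t) (h.restrict_hull_le ht) fun x hx _ =>
            Or.inl (mem_interior_iff_mem_nhds.mp (hφ.support_subset hx)))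
  have hjump' : ∀ t ∈ 𝒯, ∀ e ∈ edges t,
      size t * (∫ x, tangentialJump 𝒯 v e x ^ 2 ∂edgeMeasure e) ≤
      K₂ * (size t * bestApproxErrorSq (n + 1) (edgeMeasure e) (tangentialJump 𝒯 v e) +
        ∑ s ∈ 𝒯 with e ⊆ s, (size s ^ 2 * (∫ x in hull s, triCurl s v x ^ 2) +
            ∫ x in hull s, (G x - v x) ⬝ᵥ (G x - v x))) := fun t ht e he =>
    le_mul_bestApproxErrorSq_add hK₂ (hreg t ht).size_pos
      (hjump Ω 𝒯 h hs u G v hG hv hcr t ht e he)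
  have hD : ∀ s ∈ 𝒯, 0 ≤ size s ^ 2 * (∫ x in hull s, triCurl s v x ^ 2) +
      ∫ x in hull s, (G x - v x) ⬝ᵥ (G x - v x) := fun s _ =>
    add_nonneg (mul_nonneg (sq_nonneg _) (integral_nonneg fun x => sq_nonneg _))
      (integral_nonneg fun x => dotProduct_self_nonneg _)
  have hswap := sum_edges_sum_filter_le h.card_eq
    (fun s _ e he => h.card_filter_edge_le hs (e := e) he) hD
  have hcurlsum := Finset.sum_le_sum hcurl'
  have hjumpsum := Finset.sum_le_sum fun t ht => Finset.sum_le_sum (hjump' t ht)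
  rw [← hκ] at hswap
  simp only [← Finset.mul_sum, Finset.sum_add_distrib] at hcurlsum hjumpsum hswap
  have hEn : 0 ≤ ∑ s ∈ 𝒯, ∫ x in hull s, (G x - v x) ⬝ᵥ (G x - v x) :=
    Finset.sum_nonneg fun s _ => integral_nonneg fun x => dotProduct_self_nonneg _
  have hFn : 0 ≤ ∑ t ∈ 𝒯, size t ^ 2 * ∫ x in hull t, (f x - fh x) ^ 2 :=
    Finset.sum_nonneg fun s _ => mul_nonneg (sq_nonneg _) (integral_nonneg fun x => sq_nonneg _)
  have hbn : 0 ≤ ∑ t ∈ 𝒯, size t ^ 2 * bestApproxErrorSq n (volume.restrict (hull t))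
      (triCurl t v) :=
    Finset.sum_nonneg fun s _ => mul_nonneg (sq_nonneg _)
      (Real.iInf_nonneg fun P => integral_nonneg fun x => sq_nonneg _)
  have hjn : 0 ≤ ∑ t ∈ 𝒯, size t * ∑ e ∈ edges t, bestApproxErrorSq (n + 1) (edgeMeasure e)
      (tangentialJump 𝒯 v e) :=
    Finset.sum_nonneg fun s hs' => mul_nonneg (hreg s hs').size_pos.le
      (Finset.sum_nonneg fun e _ => Real.iInf_nonneg fun P => integral_nonneg fun x => sq_nonneg _)
  have hdn : 0 ≤ ∑ t ∈ 𝒯, size t ^ 2 * ∫ x in hull t, weakDiv Ω (p - ph) x ^ 2 :=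
    Finset.sum_nonneg fun s _ => mul_nonneg (sq_nonneg _) (integral_nonneg fun x => sq_nonneg _)
  rw [inv_mul_le_iff₀ (by positivity)]
  simp only [etaSq, etaSqLocal, oscSq, oscSqLocal, errorSq, hvdef, Finset.sum_add_distrib]
  generalize (∑ s ∈ 𝒯, ∫ x in hull s, (G x - v x) ⬝ᵥ (G x - v x)) = E at *
  generalize (∑ t ∈ 𝒯, size t ^ 2 * ∫ x in hull t, (f x - fh x) ^ 2) = R at *
  generalize (∑ t ∈ 𝒯, size t ^ 2 * bestApproxErrorSq n (volume.restrict (hull t))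
      (triCurl t v)) = b at *
  generalize (∑ t ∈ 𝒯, size t * ∑ e ∈ edges t, bestApproxErrorSq (n + 1) (edgeMeasure e)
      (tangentialJump 𝒯 v e)) = j at *
  generalize (∑ t ∈ 𝒯, size t ^ 2 * ∫ x in hull t, weakDiv Ω (p - ph) x ^ 2) = d at *
  generalize (∑ t ∈ 𝒯, size t ^ 2 * ∫ x in hull t, triCurl t v x ^ 2) = c at *
  generalize (∑ t ∈ 𝒯, size t * ∑ e ∈ edges t, ∫ x, tangentialJump 𝒯 v e x ^ 2 ∂edgeMeasure e) = J
    at *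
  generalize (∫ x in Ω, invMul A (p - ph) x ⬝ᵥ (p - ph) x) = ε at *
  generalize (∫ x in Ω, (G x - v x) ⬝ᵥ (G x - v x)) = E' at *
  have hε : E ≤ lam⁻¹ * ε := by
    rw [inv_mul_eq_div, le_div_iff₀ hlam]
    linarith [mul_le_mul_of_nonneg_left hEsum hlam.le]
  have hε0 : 0 ≤ ε := by
    by_contra! hlt
    exact absurd (hEn.trans hε) (not_le.mpr (mul_neg_of_pos_of_neg (inv_pos.mpr hlam) hlt))
  -- The curl sum left over by the jump bound is replaced by its own bound `K₁ * (b + E)`.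
  have hJ : J ≤ K₂ * (j + 3 * κ * (K₁ * (b + E) + E)) := by
    refine hjumpsum.trans (mul_le_mul_of_nonneg_left (add_le_add_right (hswap.trans ?_) _) hK₂.le)
    gcongr
  have hS : R + c + J ≤ K * (E + (b + j + R)) := by
    have h1 : 0 ≤ K₁ * (j + R) := by positivity
    have h2 : 0 ≤ K₂ * (E + b + R) := by positivity
    have h3 : 0 ≤ K₂ * (3 * κ) * (K₁ * (j + R) + b + j + R) := by positivity
    rw [hKdef]
    linarith
  rw [mul_assoc]
  refine hS.trans (mul_le_mul_of_nonneg_left ?_ hK.le)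
  have h1 : 0 ≤ lam⁻¹ * (d + (b + j + R)) := by positivity
  linarith
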